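/- **Theorem 8.2 (q-Bannai–Ito commutation).** Let $\mathbb K$ be a field and let $q\in\mathbb K$ be nonzero, not a root of unity, with a fixed square root $q^{1/2}\in\mathbb K$. Let $U=\mathfrak{osp}_q(1|2)$ be the associative $\mathbb K$-algebra generated by $A_+,A_-,K,K^{-1},P$ with relations $$KA_{\pm}K^{-1}=q^{\pm1/2}A_\pm,\quad A_+A_-+A_-A_+=\frac{K^2-K^{-2}}{q^{1/2}-q^{-1/2}},\quad PA_\pm+A_\pm P=0,\quad PK^{\pm1}=K^{\pm1}P,\quad KK^{-1}=K^{-1}K=1,\quad P^2=1,$$ with coproduct $\Delta:U\to U\otimes U$ given by $\Delta(A_\pm)=A_\pm\otimes KP+K^{-1}\otimes A_\pm$, $\Delta(K^{\pm1})=K^{\pm1}\otimes K^{\pm1}$, $\Delta(P)=P\otimes P$, and Casimir element $$\Gamma^q=\Big(-A_+A_-+\frac{q^{-1/2}K^2-q^{1/2}K^{-2}}{q-q^{-1}}\Big)P .$$ All tensor products are ordinary (ungraded) tensor products over $\mathbb K$. Let $\mathcal I_R\subseteq U$ be the subalgebra generated by $A_+K,A_-K,K^2P,\Gamma^q$, and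 $\mathcal I_L\subseteq U$ the one generated by $A_+K^{-1}P,A_-K^{-1}P,K^{-2}P,\Gamma^q$. Then $\Delta(\mathcal I_R)\subseteq U\otimes\mathcal I_R$, $\Delta(\mathcal I_L)\subseteq\mathcal I_L\otimes U$ and $\Delta(\Gamma^q)\in\mathcal I_L\otimes\mathcal I_R$, and there are unique algebra morphisms $\tau_R:\mathcal I_R\to U\otimes\mathcal I_R$ and $\tau_L:\mathcal I_L\to\mathcal I_L\otimes U$ with $$\begin{aligned} \tau_R(A_-K)&=K^2P\otimes A_-K,\qquad \tau_R(\Gamma^q)=1\otimes\Gamma^q,\\ \tau_R(K^2P)&=1\otimes K^2P-(q-q^{-1})\,A_+K\otimes A_-K,\\ \tau_R(A_+K)&=K^{-2}P\otimes A_+K+q^{-1/2}(q-q^{-1})A_+^2P\otimes A_-K\\ &\quad+q^{-1/2}(q^{1/2}-q^{-1/2})A_+K^{-1}P\otimes K^2P+q^{-1/2}(q-q^{-1})A_+K^{-1}P\otimes\Gamma^q,\\ \tau_L(A_-K^{-1}P)&=A_-K^{-1}P\otimes K^{-2}P,\qquad \tau_L(\Gamma^q)=\Gamma^q\otimes1,\\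 \tau_L(K^{-2}P)&=K^{-2}P\otimes1-(q-q^{-1})A_-K^{-1}P\otimes A_+K^{-1}P,\\ \tau_L(A_+K^{-1}P)&=A_+K^{-1}P\otimes K^2P-q^{1/2}(q-q^{-1})A_-K^{-1}P\otimes A_+^2P\\ &\quad-q^{1/2}(q^{1/2}-q^{-1/2})K^{-2}P\otimes A_+K-q^{1/2}(q-q^{-1})\Gamma^q\otimes A_+K. \end{aligned}$$ For a nonempty set $A=\{a_1<\dots<a_m\}\subseteq\{1,\dots,n\}$ an element $\Gamma^q_A\in U^{\otimes n}$ is constructed by any of the following extension processes. * *Right process.* Start with $\Gamma^q$ in tensor position $a_1$. For $p=a_1,a_1+1,\dots,a_m-1$ in this order, apply $\Delta$ (if $p\in A$) or $\tau_R$ (if $p\notin A$) to the last tensor factor, which is in position $p$, so that the last factor is then in position $p+1$. Finally put $1$ in the positions $<a_1$ and $>a_m$. * *Left process.* Start with $\Gamma^q$ in position $a_m$. For $p=a_m,a_m-1,\dots,a_1+1$ in this order, apply $\Delta$ (if $p\in A$) or $\tau_L$ (if $p\notin A$) to the first tensor factor, which is in position $p$, so that the first factor is then in position $p-1$. Finally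 put $1$ in the positions $<a_1$ and $>a_m$. * *Mixed process at $a_j$*, $1\le j\le m$. Start with $\Gamma^q$ in position $a_j$, perform the steps $p=a_j,\dots,a_m-1$ of the right process, then the steps $p=a_j,\dots,a_1+1$ of the left process, and put $1$ in the remaining positions. Moreover $\Gamma^q_\varnothing$ is the scalar $-1/(q^{1/2}+q^{-1/2})$. (The higher rank $q$-Bannai–Ito algebra is the subalgebra of $U^{\otimes n}$ generated by all the $\Gamma^q_A$.) Then for every $n$ and all $A,B\subseteq\{1,\dots,n\}$ with $B\subseteq A$, the elements $\Gamma^q_A$ and $\Gamma^q_B$ commute, whichever of the extension processes is used to construct each of them. -/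

import Mathlib

open scoped TensorProduct

namespace QBannaiIto

/-- The generators `A₊`, `A₋`, `K`, `K⁻¹`, `P` of `osp_q(1|2)`. -/
inductive Gen : Type
  | Ap | Am | K | Kinv | P

variable {𝕂 : Type*} [Field 𝕂]

open FreeAlgebra in
/-- The defining relations of `osp_q(1|2)`. Throughout, `s` stands for `q^{1/2}`, so `q = s ^ 2`. -/
inductive Rel (s : 𝕂) : FreeAlgebra 𝕂 Gen → FreeAlgebra 𝕂 Gen → Prop
  | K_Ap : Rel s (ι 𝕂 Gen.K * ι 𝕂 Gen.Ap * ι 𝕂 Gen.Kinv) (s • ι 𝕂 Gen.Ap)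
  | K_Am : Rel s (ι 𝕂 Gen.K * ι 𝕂 Gen.Am * ι 𝕂 Gen.Kinv) (s⁻¹ • ι 𝕂 Gen.Am)
  | Ap_Am : Rel s (ι 𝕂 Gen.Ap * ι 𝕂 Gen.Am + ι 𝕂 Gen.Am * ι 𝕂 Gen.Ap)
      ((s - s⁻¹)⁻¹ • (ι 𝕂 Gen.K ^ 2 - ι 𝕂 Gen.Kinv ^ 2))
  | P_Ap : Rel s (ι 𝕂 Gen.P * ι 𝕂 Gen.Ap + ι 𝕂 Gen.Ap * ι 𝕂 Gen.P) 0
  | P_Am : Rel s (ι 𝕂 Gen.P * ι 𝕂 Gen.Am + ι 𝕂 Gen.Am * ι 𝕂 Gen.P) 0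
  | P_K : Rel s (ι 𝕂 Gen.P * ι 𝕂 Gen.K) (ι 𝕂 Gen.K * ι 𝕂 Gen.P)
  | P_Kinv : Rel s (ι 𝕂 Gen.P * ι 𝕂 Gen.Kinv) (ι 𝕂 Gen.Kinv * ι 𝕂 Gen.P)
  | K_Kinv : Rel s (ι 𝕂 Gen.K * ι 𝕂 Gen.Kinv) 1
  | Kinv_K : Rel s (ι 𝕂 Gen.Kinv * ι 𝕂 Gen.K) 1
  | P_P : Rel s (ι 𝕂 Gen.P ^ 2) 1

/-- The quantum superalgebra `osp_q(1|2)` with `q^{1/2} = s`, as an associative algebra given by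
generators and relations. The `ℤ₂`-grading (`A₊`, `A₋` odd) is implemented by the involution `P`, so
that the tensor powers below are the ordinary (ungraded) ones: with them the coproduct is an algebra
morphism. -/
def Osp (s : 𝕂) : Type _ := RingQuot (Rel s)

set_option linter.unusedSimpArgs false

noncomputable section

instance (s : 𝕂) : Ring (Osp s) := inferInstanceAs (Ring (RingQuot (Rel s)))
instance (s : 𝕂) : Algebra 𝕂 (Osp s) := inferInstanceAs (Algebra 𝕂 (RingQuot (Rel s)))

namespace Osp

/-- The quotient map from the free algebra. -/
def mk (s : 𝕂) : FreeAlgebra 𝕂 Gen →ₐ[𝕂] Osp s := RingQuot.mkAlgHom 𝕂 (Rel s)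

theorem mk_rel {s : 𝕂} {x y : FreeAlgebra 𝕂 Gen} (h : Rel s x y) : mk s x = mk s y :=
  RingQuot.mkAlgHom_rel 𝕂 h

/-- The generator `A₊`. -/
def Ap (s : 𝕂) : Osp s := mk s (FreeAlgebra.ι 𝕂 Gen.Ap)
/-- The generator `A₋`. -/
def Am (s : 𝕂) : Osp s := mk s (FreeAlgebra.ι 𝕂 Gen.Am)
/-- The generator `K`. -/
def K (s : 𝕂) : Osp s := mk s (FreeAlgebra.ι 𝕂 Gen.K)
/-- The generator `K⁻¹`. -/
def Kinv (s : 𝕂) : Osp s := mk s (FreeAlgebra.ι 𝕂 Gen.Kinv)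
/-- The generator `P`. -/
def P (s : 𝕂) : Osp s := mk s (FreeAlgebra.ι 𝕂 Gen.P)

/-- Five elements of an algebra satisfy the defining relations of `osp_q(1|2)`. -/
structure Sat {X : Type*} [Ring X] [Algebra 𝕂 X] (s : 𝕂) (ap am k ki p : X) : Prop where
  K_Ap : k * ap * ki = s • ap
  K_Am : k * am * ki = s⁻¹ • am
  Ap_Am : ap * am + am * ap = (s - s⁻¹)⁻¹ • (k ^ 2 - ki ^ 2)
  P_Ap : p * ap + ap * p = 0
  P_Am : p * am + am * p = 0
  P_K : p * k = k * p
  P_Kinv : p * ki = ki * p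
  K_Kinv : k * ki = 1
  Kinv_K : ki * k = 1
  P_P : p ^ 2 = 1

theorem sat (s : 𝕂) : Sat s (Ap s) (Am s) (K s) (Kinv s) (P s) where
  K_Ap := by
    have h := mk_rel (Rel.K_Ap (s := s))
    simp only [map_mul, map_smul, map_add, map_sub, map_pow, map_zero, map_one] at h
    exact h
  K_Am := by
    have h := mk_rel (Rel.K_Am (s := s))
    simp only [map_mul, map_smul, map_add, map_sub, map_pow, map_zero, map_one] at h
    exact h
  Ap_Am := by
    have h := mk_rel (Rel.Ap_Am (s := s))
    simp only [map_mul, map_smul, map_add, map_sub, map_pow, map_zero, map_one] at h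
    exact h
  P_Ap := by
    have h := mk_rel (Rel.P_Ap (s := s))
    simp only [map_mul, map_smul, map_add, map_sub, map_pow, map_zero, map_one] at h
    exact h
  P_Am := by
    have h := mk_rel (Rel.P_Am (s := s))
    simp only [map_mul, map_smul, map_add, map_sub, map_pow, map_zero, map_one] at h
    exact h
  P_K := by
    have h := mk_rel (Rel.P_K (s := s))
    simp only [map_mul, map_smul, map_add, map_sub, map_pow, map_zero, map_one] at h
    exact h
  P_Kinv := by
    have h := mk_rel (Rel.P_Kinv (s := s))
    simp only [map_mul, map_smul, map_add, map_sub, map_pow, map_zero, map_one] at h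
    exact h
  K_Kinv := by
    have h := mk_rel (Rel.K_Kinv (s := s))
    simp only [map_mul, map_smul, map_add, map_sub, map_pow, map_zero, map_one] at h
    exact h
  Kinv_K := by
    have h := mk_rel (Rel.Kinv_K (s := s))
    simp only [map_mul, map_smul, map_add, map_sub, map_pow, map_zero, map_one] at h
    exact h
  P_P := by
    have h := mk_rel (Rel.P_P (s := s))
    simp only [map_mul, map_smul, map_add, map_sub, map_pow, map_zero, map_one] at h
    exact h

/-- The algebra morphism out of `osp_q(1|2)` defined by images of the generators that satisfy the
defining relations. -/
def lift {X : Type*} [Ring X] [Algebra 𝕂 X] {s : 𝕂} {ap am k ki p : X}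
    (h : Sat s ap am k ki p) : Osp s →ₐ[𝕂] X :=
  RingQuot.liftAlgHom 𝕂 ⟨FreeAlgebra.lift 𝕂 (fun x : Gen => match x with
    | Gen.Ap => ap | Gen.Am => am | Gen.K => k | Gen.Kinv => ki | Gen.P => p), by
    rintro x y (_ | _)
    · simpa using h.K_Ap
    · simpa using h.K_Am
    · simpa using h.Ap_Am
    · simpa using h.P_Ap
    · simpa using h.P_Am
    · simpa using h.P_K
    · simpa using h.P_Kinv
    · simpa using h.K_Kinv
    · simpa using h.Kinv_K
    · simpa using h.P_P⟩

section
variable {X : Type*} [Ring X] [Algebra 𝕂 X] {s : 𝕂} {ap am k ki p : X}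
    (h : Sat s ap am k ki p)
theorem lift_mk (x : Gen) : lift h (mk s (FreeAlgebra.ι 𝕂 x)) = (match x with
    | Gen.Ap => ap | Gen.Am => am | Gen.K => k | Gen.Kinv => ki | Gen.P => p) := by
  refine (RingQuot.liftAlgHom_mkAlgHom_apply 𝕂 _ _ _).trans ?_
  simp
theorem lift_Ap : lift h (Ap s) = ap := lift_mk h Gen.Ap
theorem lift_Am : lift h (Am s) = am := lift_mk h Gen.Am
theorem lift_K : lift h (K s) = k := lift_mk h Gen.K
theorem lift_Kinv : lift h (Kinv s) = ki := lift_mk h Gen.Kinv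
theorem lift_P : lift h (P s) = p := lift_mk h Gen.P
end

section rules
variable {X : Type*} [Ring X] [Algebra 𝕂 X] {s : 𝕂} {ap am k ki p : X}

theorem Sat.k_ap (h : Sat s ap am k ki p) : k * ap = s • (ap * k) := by
  have := congrArg (· * k) h.K_Ap
  simpa [mul_assoc, h.Kinv_K] using this
theorem Sat.k_am (h : Sat s ap am k ki p) : k * am = s⁻¹ • (am * k) := by
  have := congrArg (· * k) h.K_Am
  simpa [mul_assoc, h.Kinv_K] using this
theorem Sat.ki_ap (h : Sat s ap am k ki p) (hs : s ≠ 0) : ki * ap = s⁻¹ • (ap * ki) := by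
  have := congrArg (fun z => s⁻¹ • (ki * z)) h.K_Ap
  simp only [← mul_assoc, h.Kinv_K, one_mul, mul_smul_comm, inv_smul_smul₀ hs] at this
  exact this.symm
theorem Sat.ki_am (h : Sat s ap am k ki p) (hs : s ≠ 0) : ki * am = s • (am * ki) := by
  have := congrArg (fun z => s • (ki * z)) h.K_Am
  simp only [← mul_assoc, h.Kinv_K, one_mul, mul_smul_comm, smul_inv_smul₀ hs] at this
  exact this.symm
theorem Sat.p_ap (h : Sat s ap am k ki p) : p * ap = -(ap * p) := eq_neg_of_add_eq_zero_left h.P_Ap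
theorem Sat.p_am (h : Sat s ap am k ki p) : p * am = -(am * p) := eq_neg_of_add_eq_zero_left h.P_Am
theorem Sat.am_ap (h : Sat s ap am k ki p) :
    am * ap = (s - s⁻¹)⁻¹ • (k * k - ki * ki) - ap * am := by
  have := h.Ap_Am
  rw [sq, sq] at this
  rw [← this]; abel
theorem Sat.p_p (h : Sat s ap am k ki p) : p * p = 1 := by rw [← sq, h.P_P]
theorem lassoc {x y z : X} (h : x * y = z) (w : X) : x * (y * w) = z * w := by
  rw [← mul_assoc, h]
end rules

/-- The images of the generators under the coproduct satisfy the defining relations. -/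
theorem comul_sat {s : 𝕂} (hs : s ≠ 0) :
    Sat s (Ap s ⊗ₜ[𝕂] (K s * P s) + Kinv s ⊗ₜ[𝕂] Ap s) (Am s ⊗ₜ[𝕂] (K s * P s) + Kinv s ⊗ₜ[𝕂] Am s)
      (K s ⊗ₜ[𝕂] K s) (Kinv s ⊗ₜ[𝕂] Kinv s) (P s ⊗ₜ[𝕂] P s) := by
  have h := sat s
  constructor <;>
  simp only [add_mul, mul_add, sub_mul, mul_sub, Algebra.TensorProduct.tmul_mul_tmul, mul_assoc, sq,
    h.k_ap, h.k_am, h.ki_ap hs, h.ki_am hs, h.p_ap, h.p_am, h.am_ap, h.p_p, h.P_K, h.P_Kinv,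
    h.K_Kinv, h.Kinv_K, lassoc h.k_ap, lassoc h.k_am, lassoc (h.ki_ap hs), lassoc (h.ki_am hs),
    lassoc h.p_ap, lassoc h.p_am, lassoc h.am_ap, lassoc h.p_p, lassoc h.P_K, lassoc h.P_Kinv,
    lassoc h.K_Kinv, lassoc h.Kinv_K, smul_mul_assoc, mul_smul_comm, neg_mul, mul_neg, one_mul,
    mul_one, TensorProduct.add_tmul, TensorProduct.tmul_add,TensorProduct.sub_tmul,
    TensorProduct.tmul_sub, ← TensorProduct.smul_tmul', TensorProduct.tmul_smul,
    TensorProduct.neg_tmul, TensorProduct.tmul_neg, smul_add, smul_sub, smul_smul, smul_neg,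
    Algebra.TensorProduct.one_def] <;>
  (try match_scalars) <;> (try field_simp) <;> (try ring1)

/-- The Casimir element `Γ^q`. -/
def casimir (s : 𝕂) : Osp s :=
  (-(Ap s * Am s) + (s ^ 2 - (s ^ 2)⁻¹)⁻¹ • (s⁻¹ • K s ^ 2 - s • Kinv s ^ 2)) * P s

/-- Relations satisfied by the four generators `a, b, c, g` of either of the two coideal subalgebras
and by their images under the coactions (auxiliary, used to show that the coactions exist). -/
structure Quad {X : Type*} [Ring X] [Algebra 𝕂 X] (s : 𝕂) (a b c g : X) : Prop where
  c_a : c * a = -((s ^ 2)⁻¹ • (a * c))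
  c_b : c * b = -(s ^ 2 • (b * c))
  g_a : g * a = a * g
  g_b : g * b = b * g
  g_c : g * c = c * g
  b_a : b * a = s⁻¹ • (-(c * g) + (s ^ 2 - (s ^ 2)⁻¹)⁻¹ • (s⁻¹ • (c * c) - s • (1 : X)))
  a_b : a * b = s • (c * g + (s ^ 2 - (s ^ 2)⁻¹)⁻¹ • (s • (c * c) - s⁻¹ • (1 : X)))

section quad
variable {s : 𝕂}

theorem quad_R (hs : s ≠ 0) (h2 : s ^ 2 - 1 ≠ 0) (h2' : s ^ 2 + 1 ≠ 0) :
    Quad s (Am s * K s) (Ap s * K s) (K s ^ 2 * P s) (casimir s) := by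
  have h := sat s
  have h4 : s ^ 2 - (s ^ 2)⁻¹ = (s ^ 2 - 1) * (s ^ 2 + 1) / s ^ 2 := by field_simp; ring
  have h5 : s - s⁻¹ = (s ^ 2 - 1) / s := by field_simp
  constructor <;> try rw [casimir] <;> try rw [h4]
  all_goals
    simp only [add_mul, mul_add, sub_mul, mul_sub, mul_assoc, sq, smul_mul_assoc, mul_smul_comm,
      neg_mul, mul_neg, one_mul, mul_one, smul_add, smul_sub, smul_smul, smul_neg, neg_smul,
      neg_neg, h.k_ap, h.k_am, h.ki_ap hs, h.ki_am hs, h.p_ap, h.p_am, h.am_ap, h.p_p, h.P_K,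
      h.P_Kinv, h.K_Kinv, h.Kinv_K, lassoc h.k_ap, lassoc h.k_am, lassoc (h.ki_ap hs), lassoc
      (h.ki_am hs), lassoc h.p_ap, lassoc h.p_am, lassoc h.am_ap, lassoc h.p_p, lassoc h.P_K, lassoc
      h.P_Kinv, lassoc h.K_Kinv, lassoc h.Kinv_K, h5]
    try match_scalars
    all_goals try field_simp
    all_goals try ring1

theorem quad_L (hs : s ≠ 0) (h2 : s ^ 2 - 1 ≠ 0) (h2' : s ^ 2 + 1 ≠ 0) :
    Quad s (Ap s * Kinv s * P s) (Am s * Kinv s * P s) (Kinv s ^ 2 * P s) (casimir s) := by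
  have h := sat s
  have h4 : s ^ 2 - (s ^ 2)⁻¹ = (s ^ 2 - 1) * (s ^ 2 + 1) / s ^ 2 := by field_simp; ring
  have h5 : s - s⁻¹ = (s ^ 2 - 1) / s := by field_simp
  constructor <;> try rw [casimir] <;> try rw [h4]
  all_goals
    simp only [add_mul, mul_add, sub_mul, mul_sub, mul_assoc, sq, smul_mul_assoc, mul_smul_comm,
      neg_mul, mul_neg, one_mul, mul_one, smul_add, smul_sub, smul_smul, smul_neg, neg_smul,
      neg_neg, h.k_ap, h.k_am, h.ki_ap hs, h.ki_am hs, h.p_ap, h.p_am, h.am_ap, h.p_p, h.P_K,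
      h.P_Kinv, h.K_Kinv, h.Kinv_K, lassoc h.k_ap, lassoc h.k_am, lassoc (h.ki_ap hs), lassoc
      (h.ki_am hs), lassoc h.p_ap, lassoc h.p_am, lassoc h.am_ap, lassoc h.p_p, lassoc h.P_K, lassoc
      h.P_Kinv, lassoc h.K_Kinv, lassoc h.Kinv_K, h5]
    try match_scalars
    all_goals try field_simp
    all_goals try ring1

theorem quad_tauR {X : Type*} [Ring X] [Algebra 𝕂 X] {a b c g : X} (r : Quad s a b c g)
    (hs : s ≠ 0) (h2 : s ^ 2 - 1 ≠ 0) (h2' : s ^ 2 + 1 ≠ 0) :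
    Quad s ((K s ^ 2 * P s) ⊗ₜ[𝕂] a)
      ((Kinv s ^ 2 * P s) ⊗ₜ[𝕂] b + (s⁻¹ * (s ^ 2 - (s ^ 2)⁻¹)) • ((Ap s ^ 2 * P s) ⊗ₜ[𝕂] a)
        + (s⁻¹ * (s - s⁻¹)) • ((Ap s * Kinv s * P s) ⊗ₜ[𝕂] c)
        + (s⁻¹ * (s ^ 2 - (s ^ 2)⁻¹)) • ((Ap s * Kinv s * P s) ⊗ₜ[𝕂] g))
      ((1 : Osp s) ⊗ₜ[𝕂] c - (s ^ 2 - (s ^ 2)⁻¹) • ((Ap s * K s) ⊗ₜ[𝕂] a))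
      ((1 : Osp s) ⊗ₜ[𝕂] g) := by
  have h := sat s
  have h4 : s ^ 2 - (s ^ 2)⁻¹ = (s ^ 2 - 1) * (s ^ 2 + 1) / s ^ 2 := by field_simp; ring
  have h5 : s - s⁻¹ = (s ^ 2 - 1) / s := by field_simp
  constructor
  all_goals
    simp only [add_mul, mul_add, sub_mul, mul_sub, mul_assoc, sq, smul_mul_assoc, mul_smul_comm,
      neg_mul, mul_neg, one_mul, mul_one, smul_add, smul_sub, smul_smul, smul_neg, neg_smul,
      neg_neg, h.k_ap, h.k_am, h.ki_ap hs, h.ki_am hs, h.p_ap, h.p_am, h.am_ap, h.p_p, h.P_K,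
      h.P_Kinv, h.K_Kinv, h.Kinv_K, lassoc h.k_ap, lassoc h.k_am, lassoc (h.ki_ap hs), lassoc
      (h.ki_am hs), lassoc h.p_ap, lassoc h.p_am, lassoc h.am_ap, lassoc h.p_p, lassoc h.P_K, lassoc
      h.P_Kinv, lassoc h.K_Kinv, lassoc h.Kinv_K, r.c_a, r.c_b, r.g_a, r.g_b, r.g_c, r.b_a, r.a_b,
      lassoc r.c_a, lassoc r.c_b, lassoc r.g_a, lassoc r.g_b, lassoc r.g_c, lassoc r.b_a, lassoc
      r.a_b, Algebra.TensorProduct.tmul_mul_tmul, TensorProduct.add_tmul,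
      TensorProduct.tmul_add,TensorProduct.sub_tmul, TensorProduct.tmul_sub, ←
      TensorProduct.smul_tmul', TensorProduct.tmul_smul, TensorProduct.neg_tmul,
      TensorProduct.tmul_neg, Algebra.TensorProduct.one_def]
    try match_scalars
    all_goals try simp only [← sq, h4, h5]
    all_goals try field_simp
    all_goals try ring1

theorem quad_tauL {X : Type*} [Ring X] [Algebra 𝕂 X] {a b c g : X} (r : Quad s a b c g)
    (hs : s ≠ 0) (h2 : s ^ 2 - 1 ≠ 0) (h2' : s ^ 2 + 1 ≠ 0) :
    Quad s (a ⊗ₜ[𝕂] (K s ^ 2 * P s) - (s * (s ^ 2 - (s ^ 2)⁻¹)) • (b ⊗ₜ[𝕂] (Ap s ^ 2 * P s))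
        - (s * (s - s⁻¹)) • (c ⊗ₜ[𝕂] (Ap s * K s))
        - (s * (s ^ 2 - (s ^ 2)⁻¹)) • (g ⊗ₜ[𝕂] (Ap s * K s)))
      (b ⊗ₜ[𝕂] (Kinv s ^ 2 * P s))
      (c ⊗ₜ[𝕂] (1 : Osp s) - (s ^ 2 - (s ^ 2)⁻¹) • (b ⊗ₜ[𝕂] (Ap s * Kinv s * P s)))
      (g ⊗ₜ[𝕂] (1 : Osp s)) := by
  have h := sat s
  have h4 : s ^ 2 - (s ^ 2)⁻¹ = (s ^ 2 - 1) * (s ^ 2 + 1) / s ^ 2 := by field_simp; ring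
  have h5 : s - s⁻¹ = (s ^ 2 - 1) / s := by field_simp
  constructor
  all_goals
    simp only [add_mul, mul_add, sub_mul, mul_sub, mul_assoc, sq, smul_mul_assoc, mul_smul_comm,
      neg_mul, mul_neg, one_mul, mul_one, smul_add, smul_sub, smul_smul, smul_neg, neg_smul,
      neg_neg, h.k_ap, h.k_am, h.ki_ap hs, h.ki_am hs, h.p_ap, h.p_am, h.am_ap, h.p_p, h.P_K,
      h.P_Kinv, h.K_Kinv, h.Kinv_K, lassoc h.k_ap, lassoc h.k_am, lassoc (h.ki_ap hs), lassoc
      (h.ki_am hs), lassoc h.p_ap, lassoc h.p_am, lassoc h.am_ap, lassoc h.p_p, lassoc h.P_K, lassoc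
      h.P_Kinv, lassoc h.K_Kinv, lassoc h.Kinv_K, r.c_a, r.c_b, r.g_a, r.g_b, r.g_c, r.b_a, r.a_b,
      lassoc r.c_a, lassoc r.c_b, lassoc r.g_a, lassoc r.g_b, lassoc r.g_c, lassoc r.b_a, lassoc
      r.a_b, Algebra.TensorProduct.tmul_mul_tmul, TensorProduct.add_tmul,
      TensorProduct.tmul_add,TensorProduct.sub_tmul, TensorProduct.tmul_sub, ←
      TensorProduct.smul_tmul', TensorProduct.tmul_smul, TensorProduct.neg_tmul,
      TensorProduct.tmul_neg, Algebra.TensorProduct.one_def]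
    try match_scalars
    all_goals try simp only [← sq, h4, h5]
    all_goals try field_simp
    all_goals try ring1

end quad


/-- The normally ordered monomials `a^i c^j g^k` and `b^i c^j g^k`. -/
def mono {X : Type*} [Ring X] (a b c g : X) (w : ℤ × ℕ × ℕ) : X :=
  a ^ (-w.1).toNat * (b ^ w.1.toNat * (c ^ w.2.1 * g ^ w.2.2))

section span
variable {X : Type*} [Ring X] [Algebra 𝕂 X] {s : 𝕂} {a b c g : X}

theorem Quad.c_apow (r : Quad s a b c g) (m : ℕ) :
    c * a ^ m = (-(s ^ 2)⁻¹) ^ m • (a ^ m * c) := by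
  induction m with
  | zero => simp
  | succ m ih =>
    rw [pow_succ a, ← mul_assoc, ih, smul_mul_assoc, mul_assoc, r.c_a, ← neg_smul, mul_smul_comm,
      smul_smul, ← pow_succ, mul_assoc]

theorem Quad.c_bpow (r : Quad s a b c g) (m : ℕ) :
    c * b ^ m = (-(s ^ 2)) ^ m • (b ^ m * c) := by
  induction m with
  | zero => simp
  | succ m ih =>
    rw [pow_succ b, ← mul_assoc, ih, smul_mul_assoc, mul_assoc, r.c_b, ← neg_smul, mul_smul_comm,
      smul_smul, ← pow_succ, mul_assoc]

theorem Quad.c_mono (r : Quad s a b c g) (t : ℤ) (j k : ℕ) :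
    c * mono a b c g (t, j, k) ∈ Submodule.span 𝕂 (Set.range (mono a b c g)) := by
  have : c * mono a b c g (t, j, k) = ((-(s ^ 2)⁻¹) ^ (-t).toNat * (-(s ^ 2)) ^ t.toNat) •
      mono a b c g (t, j + 1, k) := by
    simp only [mono]
    rw [← mul_assoc, r.c_apow, smul_mul_assoc, mul_assoc, ← mul_assoc c, r.c_bpow, smul_mul_assoc,
      mul_smul_comm, smul_smul, pow_succ' c j]
    simp only [mul_assoc]
  rw [this]
  exact Submodule.smul_mem _ _ (Submodule.subset_span ⟨_, rfl⟩)

theorem Quad.g_mono (r : Quad s a b c g) (t : ℤ) (j k : ℕ) :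
    g * mono a b c g (t, j, k) = mono a b c g (t, j, k + 1) := by
  have ha : Commute g a := r.g_a
  have hb : Commute g b := r.g_b
  have hc : Commute g c := r.g_c
  simp only [mono]
  rw [← mul_assoc, (ha.pow_right _).eq, mul_assoc, ← mul_assoc g, (hb.pow_right _).eq, mul_assoc,
    ← mul_assoc g, (hc.pow_right _).eq, mul_assoc, ← pow_succ']

theorem Quad.c_mem (r : Quad s a b c g) {x : X}
    (hx : x ∈ Submodule.span 𝕂 (Set.range (mono a b c g))) :
    c * x ∈ Submodule.span 𝕂 (Set.range (mono a b c g)) := by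
  induction hx using Submodule.span_induction with
  | mem x h => obtain ⟨⟨t, j, k⟩, rfl⟩ := h; exact r.c_mono t j k
  | zero => simp
  | add x y _ _ hx hy => rw [mul_add]; exact add_mem hx hy
  | smul k x _ hx => rw [mul_smul_comm]; exact Submodule.smul_mem _ _ hx

theorem Quad.g_mem (r : Quad s a b c g) {x : X}
    (hx : x ∈ Submodule.span 𝕂 (Set.range (mono a b c g))) :
    g * x ∈ Submodule.span 𝕂 (Set.range (mono a b c g)) := by
  induction hx using Submodule.span_induction with
  | mem x h =>
    obtain ⟨⟨t, j, k⟩, rfl⟩ := h; rw [r.g_mono]; exact Submodule.subset_span ⟨_, rfl⟩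
  | zero => simp
  | add x y _ _ hx hy => rw [mul_add]; exact add_mem hx hy
  | smul k x _ hx => rw [mul_smul_comm]; exact Submodule.smul_mem _ _ hx

theorem Quad.a_mem (r : Quad s a b c g) {x : X}
    (hx : x ∈ Submodule.span 𝕂 (Set.range (mono a b c g))) :
    a * x ∈ Submodule.span 𝕂 (Set.range (mono a b c g)) := by
  induction hx using Submodule.span_induction with
  | mem x h =>
    obtain ⟨⟨t, j, k⟩, rfl⟩ := h
    rcases le_or_gt t 0 with ht | ht
    · refine Submodule.subset_span ⟨(t - 1, j, k), ?_⟩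
      have h1 : (-(t - 1)).toNat = (-t).toNat + 1 := by omega
      have h2 : (t - 1).toNat = t.toNat := by omega
      simp only [mono, h1, h2, pow_succ', mul_assoc]
    · obtain ⟨m, rfl⟩ : ∃ m : ℕ, t = m + 1 := ⟨(t - 1).toNat, by omega⟩
      have hm : mono a b c g ((m : ℤ), j, k) ∈ Submodule.span 𝕂 (Set.range (mono a b c g)) :=
        Submodule.subset_span ⟨_, rfl⟩
      have : a * mono a b c g ((m : ℤ) + 1, j, k) = a * b * mono a b c g ((m : ℤ), j, k) := by
        have h1 : (-((m : ℤ) + 1)).toNat = 0 := by omega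
        have h2 : ((m : ℤ) + 1).toNat = m + 1 := by omega
        have h3 : (-(m : ℤ)).toNat = 0 := by omega
        simp only [mono, h1, h2, h3, pow_succ', mul_assoc, pow_zero, one_mul, Int.toNat_natCast]
      rw [this, r.a_b, smul_mul_assoc, add_mul, smul_mul_assoc, sub_mul, smul_mul_assoc,
        smul_mul_assoc, one_mul, mul_assoc c g, mul_assoc c c]
      exact Submodule.smul_mem _ _ (add_mem (r.c_mem (r.g_mem hm)) (Submodule.smul_mem _ _
        (sub_mem (Submodule.smul_mem _ _ (r.c_mem (r.c_mem hm))) (Submodule.smul_mem _ _ hm))))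
  | zero => simp
  | add x y _ _ hx hy => rw [mul_add]; exact add_mem hx hy
  | smul k x _ hx => rw [mul_smul_comm]; exact Submodule.smul_mem _ _ hx

theorem Quad.b_mem (r : Quad s a b c g) {x : X}
    (hx : x ∈ Submodule.span 𝕂 (Set.range (mono a b c g))) :
    b * x ∈ Submodule.span 𝕂 (Set.range (mono a b c g)) := by
  induction hx using Submodule.span_induction with
  | mem x h =>
    obtain ⟨⟨t, j, k⟩, rfl⟩ := h
    rcases le_or_gt 0 t with ht | ht
    · refine Submodule.subset_span ⟨(t + 1, j, k), ?_⟩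
      have h1 : (-(t + 1)).toNat = 0 := by omega
      have h2 : (t + 1).toNat = t.toNat + 1 := by omega
      have h3 : (-t).toNat = 0 := by omega
      simp only [mono, h1, h2, h3, pow_succ', mul_assoc, pow_zero, one_mul]
    · obtain ⟨m, rfl⟩ : ∃ m : ℕ, t = -m - 1 := ⟨(-t - 1).toNat, by omega⟩
      have hm : mono a b c g (-(m : ℤ), j, k) ∈ Submodule.span 𝕂 (Set.range (mono a b c g)) :=
        Submodule.subset_span ⟨_, rfl⟩
      have : b * mono a b c g (-(m : ℤ) - 1, j, k) = b * a * mono a b c g (-(m : ℤ), j, k) := by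
        have h1 : (-(-(m : ℤ) - 1)).toNat = m + 1 := by omega
        have h2 : (-(m : ℤ) - 1).toNat = 0 := by omega
        have h3 : (-(m : ℤ)).toNat = 0 := by omega
        have h4 : (-(-(m : ℤ))).toNat = m := by omega
        simp only [mono, h1, h2, h3, h4, pow_succ', mul_assoc, pow_zero, one_mul]
      rw [this, r.b_a, smul_mul_assoc, add_mul, smul_mul_assoc, sub_mul, smul_mul_assoc, neg_mul,
        smul_mul_assoc, one_mul, mul_assoc c g, mul_assoc c c]
      exact Submodule.smul_mem _ _ (add_mem (neg_mem (r.c_mem (r.g_mem hm))) (Submodule.smul_mem _ _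
        (sub_mem (Submodule.smul_mem _ _ (r.c_mem (r.c_mem hm))) (Submodule.smul_mem _ _ hm))))
  | zero => simp
  | add x y _ _ hx hy => rw [mul_add]; exact add_mem hx hy
  | smul k x _ hx => rw [mul_smul_comm]; exact Submodule.smul_mem _ _ hx

theorem Quad.adjoin_le_span (r : Quad s a b c g) {x : X}
    (hx : x ∈ Algebra.adjoin 𝕂 ({a, b, c, g} : Set X)) :
    x ∈ Submodule.span 𝕂 (Set.range (mono a b c g)) := by
  have key : ∀ y ∈ Submodule.span 𝕂 (Set.range (mono a b c g)),
      x * y ∈ Submodule.span 𝕂 (Set.range (mono a b c g)) := by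
    induction hx using Algebra.adjoin_induction with
    | mem x h =>
      rcases h with rfl | rfl | rfl | rfl
      · exact fun y hy => r.a_mem hy
      · exact fun y hy => r.b_mem hy
      · exact fun y hy => r.c_mem hy
      · exact fun y hy => r.g_mem hy
    | algebraMap k => intro y hy; rw [← Algebra.smul_def]; exact Submodule.smul_mem _ _ hy
    | add x x' _ _ h h' => intro y hy; rw [add_mul]; exact add_mem (h y hy) (h' y hy)
    | mul x x' _ _ h h' => intro y hy; rw [mul_assoc]; exact h _ (h' y hy)
  simpa using key 1 (Submodule.subset_span ⟨(0, 0, 0), by simp [mono]⟩)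

/-- If the normally ordered monomials are independent, any assignment on the generators that respects
the relations extends to an algebra morphism on the subalgebra they generate. -/
theorem Quad.exists_algHom {Y : Type*} [Ring Y] [Algebra 𝕂 Y] {a' b' c' g' : Y}
    (r : Quad s a b c g) (r' : Quad s a' b' c' g') (li : LinearIndependent 𝕂 (mono a b c g)) :
    ∃ φ : Algebra.adjoin 𝕂 ({a, b, c, g} : Set X) →ₐ[𝕂] Y,
      φ ⟨a, Algebra.subset_adjoin (by simp)⟩ = a' ∧ φ ⟨b, Algebra.subset_adjoin (by simp)⟩ = b' ∧
      φ ⟨c, Algebra.subset_adjoin (by simp)⟩ = c' ∧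
      φ ⟨g, Algebra.subset_adjoin (by simp)⟩ = g' := by
  have rp : Quad s (a, a') (b, b') (c, c') (g, g') :=
    ⟨Prod.ext r.c_a r'.c_a, Prod.ext r.c_b r'.c_b, Prod.ext r.g_a r'.g_a, Prod.ext r.g_b r'.g_b,
      Prod.ext r.g_c r'.g_c, Prod.ext r.b_a r'.b_a, Prod.ext r.a_b r'.a_b⟩
  set S := Algebra.adjoin 𝕂 ({(a, a'), (b, b'), (c, c'), (g, g')} : Set (X × Y)) with hS
  let p : S →ₐ[𝕂] X := (AlgHom.fst 𝕂 X Y).comp S.val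
  have hmono : ∀ w, (mono (a, a') (b, b') (c, c') (g, g') w).1 = mono a b c g w := fun w => rfl
  have hp : Function.Injective p := by
    rw [injective_iff_map_eq_zero]
    rintro ⟨z, hz⟩ h0
    have h1 := rp.adjoin_le_span hz
    rw [Finsupp.mem_span_range_iff_exists_finsupp] at h1
    obtain ⟨w, rfl⟩ := h1
    have h2 : (w.sum fun i k => k • mono a b c g i) = 0 := by
      have h3 : (AlgHom.fst 𝕂 X Y) (w.sum fun i k => k • mono (a, a') (b, b') (c, c') (g, g') i)
        = 0 := h0
      rw [map_finsuppSum] at h3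
      exact h3
    have h4 : w = 0 := (linearIndependent_iff.1 li) w (by
      rw [Finsupp.linearCombination_apply]; exact h2)
    subst h4
    rfl
  have hr : p.range = Algebra.adjoin 𝕂 ({a, b, c, g} : Set X) := by
    rw [AlgHom.range_comp, Subalgebra.range_val, hS, AlgHom.map_adjoin]
    congr 1
    simp [Set.image_insert_eq]
  let e := AlgEquiv.ofInjective p hp
  have key : ∀ (x : X) (y : Y) (h : (x, y) ∈ S)
      (hx : x ∈ Algebra.adjoin 𝕂 ({a, b, c, g} : Set X)),
      ((((AlgHom.snd 𝕂 X Y).comp S.val).comp (e.symm : p.range →ₐ[𝕂] S)).comp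
        (Subalgebra.equivOfEq _ _ hr.symm).toAlgHom) ⟨x, hx⟩ = y := by
    intro x y h hx
    have : (Subalgebra.equivOfEq _ _ hr.symm).toAlgHom ⟨x, hx⟩ = e ⟨(x, y), h⟩ := by
      apply Subtype.ext; rfl
    rw [AlgHom.comp_apply, this]
    simp
  refine ⟨_, key _ _ ?_ _, key _ _ ?_ _, key _ _ ?_ _, key _ _ ?_ _⟩ <;>
    exact Algebra.subset_adjoin (by simp)

/-- Independence of the normally ordered monomials, from a representation by weighted shifts. -/
theorem linearIndependent_mono {R : Type*} [CommRing R] [IsDomain R] [Algebra 𝕂 R]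
    (ρ : X →ₐ[𝕂] Module.End 𝕂 (ℤ → R)) (ε : ℤ) (hε : ε ≠ 0) (x y z : ℤ → R) (γ : R)
    (ha : ∀ v n, ρ a v n = x n * v (n + ε)) (hb : ∀ v n, ρ b v n = y n * v (n - ε))
    (hc : ∀ v n, ρ c v n = z n * v n) (hg : ∀ v n, ρ g v n = γ * v n)
    (hx : ∀ n, x n ≠ 0) (hy : ∀ n, y n ≠ 0)
    (li : LinearIndependent 𝕂 (fun w : ℕ × ℕ => z 0 ^ w.1 * γ ^ w.2)) :
    LinearIndependent 𝕂 (mono a b c g) := by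
  have ha1 : ∀ (m : ℕ) (p : ℤ), ∃ u : R, u ≠ 0 ∧
      ∀ r : R, ρ (a ^ m) (Pi.single p r) = Pi.single (p - ε * m) (u * r) := by
    intro m p
    induction m with
    | zero => exact ⟨1, one_ne_zero, fun r => by simp⟩
    | succ m ih =>
      obtain ⟨u, hu, h⟩ := ih
      refine ⟨x (p - ε * m - ε) * u, mul_ne_zero (hx _) hu, fun r => ?_⟩
      rw [pow_succ', map_mul, Module.End.mul_apply, h]
      ext n
      rw [ha]
      rcases eq_or_ne n (p - ε * m - ε) with rfl | hn
      · have : p - ε * ((m + 1 : ℕ) : ℤ) = p - ε * m - ε := by push_cast; ring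
        rw [this]; simp [mul_assoc]
      · have : p - ε * ((m + 1 : ℕ) : ℤ) = p - ε * m - ε := by push_cast; ring
        rw [this, Pi.single_eq_of_ne hn, Pi.single_eq_of_ne (by omega), mul_zero]
  have hb1 : ∀ (m : ℕ) (p : ℤ), ∃ u : R, u ≠ 0 ∧
      ∀ r : R, ρ (b ^ m) (Pi.single p r) = Pi.single (p + ε * m) (u * r) := by
    intro m p
    induction m with
    | zero => exact ⟨1, one_ne_zero, fun r => by simp⟩
    | succ m ih =>
      obtain ⟨u, hu, h⟩ := ih
      refine ⟨y (p + ε * m + ε) * u, mul_ne_zero (hy _) hu, fun r => ?_⟩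
      rw [pow_succ', map_mul, Module.End.mul_apply, h]
      ext n
      rw [hb]
      have : p + ε * ((m + 1 : ℕ) : ℤ) = p + ε * m + ε := by push_cast; ring
      rcases eq_or_ne n (p + ε * m + ε) with rfl | hn
      · rw [this]; simp [mul_assoc]
      · rw [this, Pi.single_eq_of_ne hn, Pi.single_eq_of_ne (by omega), mul_zero]
  have hc1 : ∀ (m : ℕ) (r : R), ρ (c ^ m) (Pi.single 0 r) = Pi.single 0 (z 0 ^ m * r) := by
    intro m r
    induction m with
    | zero => simp
    | succ m ih =>
      rw [pow_succ', map_mul, Module.End.mul_apply, ih]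
      ext n
      rw [hc]
      rcases eq_or_ne n 0 with rfl | hn
      · simp [pow_succ', mul_assoc]
      · simp [Pi.single_eq_of_ne hn]
  have hg1 : ∀ (m : ℕ) (r : R), ρ (g ^ m) (Pi.single 0 r) = Pi.single 0 (γ ^ m * r) := by
    intro m r
    induction m with
    | zero => simp
    | succ m ih =>
      rw [pow_succ', map_mul, Module.End.mul_apply, ih]
      ext n
      rw [hg]
      rcases eq_or_ne n 0 with rfl | hn
      · simp [pow_succ', mul_assoc]
      · simp [Pi.single_eq_of_ne hn]
  have hm : ∀ t : ℤ, ∃ u : R, u ≠ 0 ∧ ∀ j k : ℕ,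
      ρ (mono a b c g (t, j, k)) (Pi.single 0 1) = Pi.single (ε * t) (u * (z 0 ^ j * γ ^ k)) := by
    intro t
    obtain ⟨u, hu, h⟩ := hb1 t.toNat 0
    obtain ⟨u', hu', h'⟩ := ha1 (-t).toNat (0 + ε * t.toNat)
    refine ⟨u' * u, mul_ne_zero hu' hu, fun j k => ?_⟩
    have ht : 0 + ε * (t.toNat : ℤ) - ε * ((-t).toNat : ℤ) = ε * t := by
      rw [zero_add, ← mul_sub, Int.toNat_sub_toNat_neg]
    simp only [mono, map_mul, Module.End.mul_apply]
    rw [hg1, hc1, h, h', ht]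
    simp [mul_assoc]
  choose u hu hm using hm
  rw [linearIndependent_iff'']
  rintro S f hf h0 ⟨t, jk⟩
  classical
  have h1 : ∑ w ∈ (S.image Prod.fst) ×ˢ (S.image Prod.snd), f w • mono a b c g w = 0 := by
    rw [← h0]
    symm
    apply Finset.sum_subset
    · intro w hw
      exact Finset.mem_product.2 ⟨Finset.mem_image_of_mem _ hw, Finset.mem_image_of_mem _ hw⟩
    · intro w _ hw; rw [hf w hw, zero_smul]
  by_cases ht : t ∈ S.image Prod.fst
  swap
  · exact hf _ fun h => ht (Finset.mem_image_of_mem Prod.fst h)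
  by_cases hjk : jk ∈ S.image Prod.snd
  swap
  · exact hf _ fun h => hjk (Finset.mem_image_of_mem Prod.snd h)
  have h2 := congrArg (fun X => ρ X (Pi.single 0 1) (ε * t)) h1
  simp only [map_sum, map_smul, LinearMap.sum_apply, LinearMap.smul_apply, Finset.sum_apply,
    Pi.smul_apply, map_zero, LinearMap.zero_apply, Pi.zero_apply] at h2
  rw [Finset.sum_product, Finset.sum_eq_single_of_mem t ht] at h2
  · simp only [hm, Pi.single_eq_same] at h2
    simp only [← mul_smul_comm (_ : 𝕂) (u t)] at h2
    rw [← Finset.mul_sum] at h2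
    have h3 := (mul_eq_zero.1 h2).resolve_left (hu t)
    exact (linearIndependent_iff'.1 li) _ (fun w => f (t, w)) h3 jk hjk
  · intro t' _ hne
    apply Finset.sum_eq_zero
    intro w _
    rw [hm, Pi.single_eq_of_ne, smul_zero]
    intro h
    exact hne (mul_left_cancel₀ hε h).symm

end span

section rep

/-- Coefficient ring of an auxiliary representation with two free parameters. -/
abbrev WRing (𝕂 : Type*) [Field 𝕂] : Type _ := LaurentPolynomial (Polynomial 𝕂)

open LaurentPolynomial in
theorem li_T (e : ℤ) (he : e ≠ 0) : LinearIndependent 𝕂 (fun w : ℕ × ℕ =>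
    (T e : WRing 𝕂) ^ w.1 * (C Polynomial.X : WRing 𝕂) ^ w.2) := by
  have h : (fun w : ℕ × ℕ => (T e : WRing 𝕂) ^ w.1 * (C Polynomial.X : WRing 𝕂) ^ w.2) =
      fun w => C (Polynomial.X ^ w.2) * T (e * w.1) := by
    funext w
    rw [T_pow, ← map_pow, mul_comm, mul_comm e]
  rw [h, linearIndependent_iff'']
  rintro S f hf h0 ⟨j, k⟩
  by_contra hne
  have hmem : (j, k) ∈ S := by
    by_contra h; exact hne (hf _ h)
  have h1 := congrArg (fun p : WRing 𝕂 => (p.coeff (e * j)).coeff k) h0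
  simp only [AddMonoidAlgebra.coeff_sum, AddMonoidAlgebra.coeff_smul, ← single_eq_C_mul_T,
    AddMonoidAlgebra.coeff_single, Finsupp.coe_finsetSum, Finset.sum_apply, Finsupp.smul_apply,
    AddMonoidAlgebra.coeff_zero, Finsupp.coe_zero, Pi.zero_apply, Polynomial.coeff_zero,
    Polynomial.finsetSum_coeff, Polynomial.coeff_smul] at h1
  rw [Finset.sum_eq_single_of_mem _ hmem] at h1
  · simp at h1; exact hne h1
  · rintro ⟨j', k'⟩ _ hn
    rcases eq_or_ne j' j with rfl | hj
    · have : k ≠ k' := fun h => hn (by rw [h])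
      simp [Polynomial.coeff_X_pow, this]
    · have : e * (j' : ℤ) ≠ e * j := fun h => hj (by exact_mod_cast mul_left_cancel₀ he h)
      simp [Finsupp.single_apply, this]

/-- Weighted shift operator. -/
def wop (w : ℤ → WRing 𝕂) (e : ℤ) : Module.End 𝕂 (ℤ → WRing 𝕂) where
  toFun v n := w n * v (n + e)
  map_add' v v' := by ext1 n; simp [mul_add]
  map_smul' k v := by ext1 n; simp

theorem wop_apply (w : ℤ → WRing 𝕂) (e : ℤ) (v : ℤ → WRing 𝕂) (n : ℤ) :
    wop w e v n = w n * v (n + e) := rfl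

open LaurentPolynomial in
/-- The weights of `A₊` in the auxiliary representation. -/
def alpha (s : 𝕂) (n : ℤ) : WRing 𝕂 :=
  (-(-1 : 𝕂) ^ n) • C Polynomial.X + (s ^ 2 - (s ^ 2)⁻¹)⁻¹ • ((s⁻¹ * s ^ (2 * n)) • T 2 - (s * s ^ (-2 * n)) • T (-2))

open LaurentPolynomial in
theorem alpha_ne_zero (s : 𝕂) (n : ℤ) : alpha s n ≠ 0 := by
  intro h
  have h1 := congrArg (fun p : WRing 𝕂 => (p.coeff 0).coeff 1) h
  simp [alpha] at h1
  exact zpow_ne_zero n (by simp) h1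

open LaurentPolynomial in
theorem rep_sat {s : 𝕂} (hs : s ≠ 0) (h2 : s ^ 2 - 1 ≠ 0) (h2' : s ^ 2 + 1 ≠ 0) :
    Sat s (wop (alpha s) (-1)) (wop (fun _ => 1) 1) (wop (fun n => s ^ n • T 1) 0)
      (wop (fun n => s ^ (-n) • T (-1)) 0) (wop (fun n => (-1 : 𝕂) ^ n • 1) 0) := by
  have h4 : s ^ 2 - (s ^ 2)⁻¹ = (s ^ 2 - 1) * (s ^ 2 + 1) / s ^ 2 := by field_simp; ring
  have h5 : s - s⁻¹ = (s ^ 2 - 1) / s := by field_simp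
  have e1 : ∀ n : ℤ, s ^ (n + 1) = s ^ n * s := fun n => zpow_add_one₀ hs n
  have e2 : ∀ n : ℤ, s ^ (n - 1) = s ^ n * s⁻¹ := fun n => zpow_sub_one₀ hs n
  have e3 : ∀ n : ℤ, (-1 : 𝕂) ^ (n + 1) = -(-1) ^ n := fun n => by
    rw [zpow_add_one₀ (by simp)]; ring
  have e4 : ∀ n : ℤ, (-1 : 𝕂) ^ (n - 1) = -(-1) ^ n := fun n => by
    rw [zpow_sub_one₀ (by simp)]; simp
  have e5 : ∀ n : ℤ, s ^ (2 * n) = (s ^ n) ^ 2 := fun n => by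
    rw [mul_comm, zpow_mul]; norm_cast
  have e6 : ∀ n : ℤ, s ^ (-n) = (s ^ n)⁻¹ := fun n => zpow_neg s n
  have e7 : ∀ n : ℤ, (-1 : 𝕂) ^ n * (-1) ^ n = 1 := fun n => by
    rw [← mul_zpow]; simp
  have e8 : ∀ n : ℤ, s ^ n ≠ 0 := fun n => zpow_ne_zero n hs
  have hT : ∀ x : WRing 𝕂, T 1 * x * T (-1) = x := fun x => by
    rw [mul_right_comm, ← T_add, add_neg_cancel, T_zero, one_mul]
  constructor
  all_goals
    refine LinearMap.ext fun v => funext fun n => ?_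
    simp only [sq, Module.End.mul_apply, LinearMap.add_apply, LinearMap.sub_apply,
      LinearMap.smul_apply, Pi.add_apply, Pi.sub_apply, Pi.smul_apply, wop_apply, alpha,
      LinearMap.zero_apply, Pi.zero_apply, Module.End.one_apply, add_zero, add_neg_cancel_right,
      neg_add_cancel_right, ← sub_eq_add_neg, sub_add_cancel, add_sub_cancel_right, one_mul]
    try simp only [neg_mul, e5, e6, e1, e2, e3, e4]
    simp only [mul_add, add_mul, mul_sub, sub_mul, smul_mul_assoc, mul_smul_comm, smul_add,
      smul_sub, smul_smul, ← mul_assoc, ← T_add, one_mul, mul_one, neg_mul, mul_neg, e7, neg_neg, T_zero]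
    try norm_num only [T_zero, one_mul, hT, neg_mul, smul_mul_assoc]
    try match_scalars
    all_goals try simp only [← sq, h4, h5]
    all_goals have e9 := e8 n
    all_goals try field_simp
    all_goals try ring1

/-- Independence of the normally ordered monomials in both coideal subalgebras. -/
theorem linearIndependent_monos {s : 𝕂} (hs : s ≠ 0) (h2 : s ^ 2 - 1 ≠ 0) (h2' : s ^ 2 + 1 ≠ 0) :
    LinearIndependent 𝕂 (mono (Am s * K s) (Ap s * K s) (K s ^ 2 * P s) (casimir s)) ∧
    LinearIndependent 𝕂 (mono (Ap s * Kinv s * P s) (Am s * Kinv s * P s) (Kinv s ^ 2 * P s)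
      (casimir s)) := by
  have hr := rep_sat hs h2 h2'
  have e8 : ∀ n : ℤ, s ^ n ≠ 0 := fun n => zpow_ne_zero n hs
  have e9 : ∀ n : ℤ, (-1 : 𝕂) ^ n ≠ 0 := fun n => zpow_ne_zero n (by simp)
  have e7 : ∀ n : ℤ, (-1 : 𝕂) ^ n * (-1) ^ n = 1 := fun n => by
    rw [← mul_zpow]; simp
  have e5 : ∀ n : ℤ, s ^ (2 * n) = (s ^ n) ^ 2 := fun n => by
    rw [mul_comm, zpow_mul]; norm_cast
  have e6 : ∀ n : ℤ, s ^ (-n) = (s ^ n)⁻¹ := fun n => zpow_neg s n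
  have hT : ∀ e : ℤ, (LaurentPolynomial.T e : WRing 𝕂) ≠ 0 := fun e =>
    (LaurentPolynomial.isUnit_T e).ne_zero
  have hg : ∀ v n, lift hr (casimir s) v n = LaurentPolynomial.C Polynomial.X * v n := by
    intro v n
    simp only [casimir, map_mul, map_add, map_neg, map_smul, map_sub, map_pow, lift_Ap, lift_Am,
      lift_K, lift_Kinv, lift_P, sq, Module.End.mul_apply, LinearMap.add_apply,
      LinearMap.sub_apply, LinearMap.neg_apply, Pi.neg_apply,
      LinearMap.smul_apply, Pi.add_apply, Pi.sub_apply, Pi.smul_apply, wop_apply, alpha,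
      add_zero, ← sub_eq_add_neg, sub_add_cancel]
    simp only [neg_mul, e5, e6]
    simp only [mul_add, add_mul, mul_sub, sub_mul, smul_mul_assoc, mul_smul_comm, smul_add,
      smul_sub, smul_smul, ← mul_assoc, ← LaurentPolynomial.T_add, one_mul, mul_one, neg_mul,
      mul_neg, e7, neg_neg, LaurentPolynomial.T_zero]
    try norm_num only
    match_scalars
    all_goals have := e8 n
    all_goals try field_simp
    all_goals try ring1
  constructor
  · refine linearIndependent_mono (lift hr) 1 one_ne_zero
      (fun n => s ^ (n + 1) • LaurentPolynomial.T 1)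
      (fun n => alpha s n * s ^ (n - 1) • LaurentPolynomial.T 1)
      (fun n => (s ^ n * s ^ n * (-1) ^ n) • LaurentPolynomial.T 2)
      (LaurentPolynomial.C Polynomial.X) ?_ ?_ ?_ hg ?_ ?_ ?_
    · intro v n
      simp [lift_Am, lift_K, wop_apply]
    · intro v n
      simp [lift_Ap, lift_K, wop_apply, sub_eq_add_neg]
      simp only [Algebra.smul_def, map_mul]
      ring
    · intro v n
      simp [lift_P, lift_K, wop_apply, sq]
      simp only [Algebra.smul_def, map_mul]
      ring
    · exact fun n => smul_ne_zero (e8 _) (hT _)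
    · exact fun n => mul_ne_zero (alpha_ne_zero s n) (smul_ne_zero (e8 _) (hT _))
    · simpa using li_T (𝕂 := 𝕂) 2 (by norm_num)
  · refine linearIndependent_mono (lift hr) (-1) (by norm_num)
      (fun n => alpha s n * ((s ^ (n - 1))⁻¹ * (-1) ^ (n - 1)) • LaurentPolynomial.T (-1))
      (fun n => ((s ^ (n + 1))⁻¹ * (-1) ^ (n + 1)) • LaurentPolynomial.T (-1))
      (fun n => (s ^ (-n) * s ^ (-n) * (-1) ^ n) • LaurentPolynomial.T (-2))
      (LaurentPolynomial.C Polynomial.X) ?_ ?_ ?_ hg ?_ ?_ ?_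
    · intro v n
      simp [lift_Ap, lift_Kinv, lift_P, wop_apply, sub_eq_add_neg]
      simp only [Algebra.smul_def, map_mul]
      ring
    · intro v n
      simp [lift_Am, lift_Kinv, lift_P, wop_apply]
      simp only [Algebra.smul_def, map_mul]
      ring
    · intro v n
      simp [lift_P, lift_Kinv, wop_apply, sq]
      simp only [Algebra.smul_def, map_mul]
      ring
    · exact fun n => mul_ne_zero (alpha_ne_zero s n)
        (smul_ne_zero (mul_ne_zero (inv_ne_zero (e8 _)) (e9 _)) (hT _))
    · exact fun n => smul_ne_zero (mul_ne_zero (inv_ne_zero (e8 _)) (e9 _)) (hT _)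
    · simpa using li_T (𝕂 := 𝕂) (-2) (by norm_num)

end rep

/-- `s = q^{1/2}` with `q = s ^ 2` nonzero and not a root of unity. -/
structure IsGeneric (s : 𝕂) : Prop where
  ne_zero : s ≠ 0
  not_root_of_unity : ∀ m : ℕ, 0 < m → (s ^ 2) ^ m ≠ 1

theorem IsGeneric.sub_ne {s : 𝕂} (hs : IsGeneric s) : s ^ 2 - 1 ≠ 0 := fun h =>
  hs.not_root_of_unity 1 one_pos (by rw [pow_one]; exact sub_eq_zero.1 h)

theorem IsGeneric.add_ne {s : 𝕂} (hs : IsGeneric s) : s ^ 2 + 1 ≠ 0 := fun h =>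
  hs.not_root_of_unity 2 two_pos (by rw [eq_neg_of_add_eq_zero_left h]; simp)

variable {s : 𝕂}

/-- The coproduct `Δ`: `Δ(A±) = A± ⊗ K P + K⁻¹ ⊗ A±`, `Δ(K^{±1}) = K^{±1} ⊗ K^{±1}`,
`Δ(P) = P ⊗ P`. -/
def comul (hs : IsGeneric s) : Osp s →ₐ[𝕂] Osp s ⊗[𝕂] Osp s := lift (comul_sat hs.ne_zero)

/-- The left coideal subalgebra `I_R`, generated by `A₊K`, `A₋K`, `K²P` and `Γ^q`. -/
def IR (s : 𝕂) : Subalgebra 𝕂 (Osp s) :=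
  Algebra.adjoin 𝕂 {Am s * K s, Ap s * K s, K s ^ 2 * P s, casimir s}

/-- The right coideal subalgebra `I_L`, generated by `A₊K⁻¹P`, `A₋K⁻¹P`, `K⁻²P` and `Γ^q`. -/
def IL (s : 𝕂) : Subalgebra 𝕂 (Osp s) :=
  Algebra.adjoin 𝕂 {Ap s * Kinv s * P s, Am s * Kinv s * P s, Kinv s ^ 2 * P s, casimir s}

namespace IR
/-- `A₋K` as an element of `I_R`. -/
def AmK (s : 𝕂) : IR s := ⟨Am s * K s, Algebra.subset_adjoin (by simp)⟩
/-- `A₊K` as an element of `I_R`. -/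
def ApK (s : 𝕂) : IR s := ⟨Ap s * K s, Algebra.subset_adjoin (by simp)⟩
/-- `K²P` as an element of `I_R`. -/
def K2P (s : 𝕂) : IR s := ⟨K s ^ 2 * P s, Algebra.subset_adjoin (by simp)⟩
/-- `Γ^q` as an element of `I_R`. -/
def cas (s : 𝕂) : IR s := ⟨casimir s, Algebra.subset_adjoin (by simp)⟩
end IR

namespace IL
/-- `A₊K⁻¹P` as an element of `I_L`. -/
def ApKinvP (s : 𝕂) : IL s := ⟨Ap s * Kinv s * P s, Algebra.subset_adjoin (by simp)⟩
/-- `A₋K⁻¹P` as an element of `I_L`. -/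
def AmKinvP (s : 𝕂) : IL s := ⟨Am s * Kinv s * P s, Algebra.subset_adjoin (by simp)⟩
/-- `K⁻²P` as an element of `I_L`. -/
def Kinv2P (s : 𝕂) : IL s := ⟨Kinv s ^ 2 * P s, Algebra.subset_adjoin (by simp)⟩
/-- `Γ^q` as an element of `I_L`. -/
def cas (s : 𝕂) : IL s := ⟨casimir s, Algebra.subset_adjoin (by simp)⟩
end IL

/-- The formulas that define the coaction `τ_R` on the generators of `I_R`. -/
structure IsTauR (τ : IR s →ₐ[𝕂] Osp s ⊗[𝕂] IR s) : Prop where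
  AmK : τ (IR.AmK s) = (K s ^ 2 * P s) ⊗ₜ[𝕂] IR.AmK s
  ApK : τ (IR.ApK s) = (Kinv s ^ 2 * P s) ⊗ₜ[𝕂] IR.ApK s
    + (s⁻¹ * (s ^ 2 - (s ^ 2)⁻¹)) • ((Ap s ^ 2 * P s) ⊗ₜ[𝕂] IR.AmK s)
    + (s⁻¹ * (s - s⁻¹)) • ((Ap s * Kinv s * P s) ⊗ₜ[𝕂] IR.K2P s)
    + (s⁻¹ * (s ^ 2 - (s ^ 2)⁻¹)) • ((Ap s * Kinv s * P s) ⊗ₜ[𝕂] IR.cas s)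
  K2P : τ (IR.K2P s) = (1 : Osp s) ⊗ₜ[𝕂] IR.K2P s
    - (s ^ 2 - (s ^ 2)⁻¹) • ((Ap s * K s) ⊗ₜ[𝕂] IR.AmK s)
  cas : τ (IR.cas s) = (1 : Osp s) ⊗ₜ[𝕂] IR.cas s

/-- The formulas that define the coaction `τ_L` on the generators of `I_L`. -/
structure IsTauL (τ : IL s →ₐ[𝕂] IL s ⊗[𝕂] Osp s) : Prop where
  AmKinvP : τ (IL.AmKinvP s) = IL.AmKinvP s ⊗ₜ[𝕂] (Kinv s ^ 2 * P s)
  ApKinvP : τ (IL.ApKinvP s) = IL.ApKinvP s ⊗ₜ[𝕂] (K s ^ 2 * P s)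
    - (s * (s ^ 2 - (s ^ 2)⁻¹)) • (IL.AmKinvP s ⊗ₜ[𝕂] (Ap s ^ 2 * P s))
    - (s * (s - s⁻¹)) • (IL.Kinv2P s ⊗ₜ[𝕂] (Ap s * K s))
    - (s * (s ^ 2 - (s ^ 2)⁻¹)) • (IL.cas s ⊗ₜ[𝕂] (Ap s * K s))
  Kinv2P : τ (IL.Kinv2P s) = IL.Kinv2P s ⊗ₜ[𝕂] (1 : Osp s)
    - (s ^ 2 - (s ^ 2)⁻¹) • (IL.AmKinvP s ⊗ₜ[𝕂] (Ap s * Kinv s * P s))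
  cas : τ (IL.cas s) = IL.cas s ⊗ₜ[𝕂] (1 : Osp s)

theorem quad_IR (hs : IsGeneric s) : Quad s (IR.AmK s) (IR.ApK s) (IR.K2P s) (IR.cas s) := by
  have h := quad_R hs.ne_zero hs.sub_ne hs.add_ne
  exact ⟨Subtype.ext h.c_a, Subtype.ext h.c_b, Subtype.ext h.g_a, Subtype.ext h.g_b,
    Subtype.ext h.g_c, Subtype.ext h.b_a, Subtype.ext h.a_b⟩

theorem quad_IL (hs : IsGeneric s) :
    Quad s (IL.ApKinvP s) (IL.AmKinvP s) (IL.Kinv2P s) (IL.cas s) := by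
  have h := quad_L hs.ne_zero hs.sub_ne hs.add_ne
  exact ⟨Subtype.ext h.c_a, Subtype.ext h.c_b, Subtype.ext h.g_a, Subtype.ext h.g_b,
    Subtype.ext h.g_c, Subtype.ext h.b_a, Subtype.ext h.a_b⟩

theorem exists_tauR (hs : IsGeneric s) : ∃ τ : IR s →ₐ[𝕂] Osp s ⊗[𝕂] IR s, IsTauR τ := by
  obtain ⟨φ, h1, h2, h3, h4⟩ :=
    (quad_R hs.ne_zero hs.sub_ne hs.add_ne).exists_algHom
      (quad_tauR (quad_IR hs) hs.ne_zero hs.sub_ne hs.add_ne)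
      (linearIndependent_monos hs.ne_zero hs.sub_ne hs.add_ne).1
  exact ⟨φ, h1, h2, h3, h4⟩

theorem exists_tauL (hs : IsGeneric s) : ∃ τ : IL s →ₐ[𝕂] IL s ⊗[𝕂] Osp s, IsTauL τ := by
  obtain ⟨φ, h1, h2, h3, h4⟩ :=
    (quad_L hs.ne_zero hs.sub_ne hs.add_ne).exists_algHom
      (quad_tauL (quad_IL hs) hs.ne_zero hs.sub_ne hs.add_ne)
      (linearIndependent_monos hs.ne_zero hs.sub_ne hs.add_ne).2
  exact ⟨φ, h2, h1, h3, h4⟩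

theorem algHom_ext_IR {Y : Type*} [Semiring Y] [Algebra 𝕂 Y] {φ ψ : IR s →ₐ[𝕂] Y}
    (h1 : φ (IR.AmK s) = ψ (IR.AmK s)) (h2 : φ (IR.ApK s) = ψ (IR.ApK s))
    (h3 : φ (IR.K2P s) = ψ (IR.K2P s)) (h4 : φ (IR.cas s) = ψ (IR.cas s)) : φ = ψ := by
  refine AlgHom.adjoin_ext ?_
  rintro x (rfl | rfl | rfl | rfl)
  exacts [h1, h2, h3, h4]

theorem algHom_ext_IL {Y : Type*} [Semiring Y] [Algebra 𝕂 Y] {φ ψ : IL s →ₐ[𝕂] Y}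
    (h1 : φ (IL.ApKinvP s) = ψ (IL.ApKinvP s)) (h2 : φ (IL.AmKinvP s) = ψ (IL.AmKinvP s))
    (h3 : φ (IL.Kinv2P s) = ψ (IL.Kinv2P s)) (h4 : φ (IL.cas s) = ψ (IL.cas s)) : φ = ψ := by
  refine AlgHom.adjoin_ext ?_
  rintro x (rfl | rfl | rfl | rfl)
  exacts [h1, h2, h3, h4]

/-- The formulas determine `τ_R`. -/
theorem IsTauR.unique {τ τ' : IR s →ₐ[𝕂] Osp s ⊗[𝕂] IR s} (h : IsTauR τ) (h' : IsTauR τ') :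
    τ = τ' :=
  algHom_ext_IR (h.AmK.trans h'.AmK.symm) (h.ApK.trans h'.ApK.symm) (h.K2P.trans h'.K2P.symm)
    (h.cas.trans h'.cas.symm)

/-- The formulas determine `τ_L`. -/
theorem IsTauL.unique {τ τ' : IL s →ₐ[𝕂] IL s ⊗[𝕂] Osp s} (h : IsTauL τ) (h' : IsTauL τ') :
    τ = τ' :=
  algHom_ext_IL (h.ApKinvP.trans h'.ApKinvP.symm) (h.AmKinvP.trans h'.AmKinvP.symm)
    (h.Kinv2P.trans h'.Kinv2P.symm) (h.cas.trans h'.cas.symm)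

/-- The coaction `τ_R : I_R → osp_q(1|2) ⊗ I_R`, the unique algebra morphism with `IsTauR`. -/
def tauR (hs : IsGeneric s) : IR s →ₐ[𝕂] Osp s ⊗[𝕂] IR s := (exists_tauR hs).choose

theorem isTauR_tauR (hs : IsGeneric s) : IsTauR (tauR hs) := (exists_tauR hs).choose_spec

/-- The coaction `τ_L : I_L → I_L ⊗ osp_q(1|2)`, the unique algebra morphism with `IsTauL`. -/
def tauL (hs : IsGeneric s) : IL s →ₐ[𝕂] IL s ⊗[𝕂] Osp s := (exists_tauL hs).choose

theorem isTauL_tauL (hs : IsGeneric s) : IsTauL (tauL hs) := (exists_tauL hs).choose_spec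

/-- `Δ(Γ^q)` as an element of `I_L ⊗ I_R`, see `casimirLR_spec`. -/
def casimirLR (s : 𝕂) : IL s ⊗[𝕂] IR s :=
  IL.cas s ⊗ₜ[𝕂] IR.K2P s + IL.Kinv2P s ⊗ₜ[𝕂] IR.cas s
    + ((s - s⁻¹) / (s ^ 2 - (s ^ 2)⁻¹)) • (IL.Kinv2P s ⊗ₜ[𝕂] IR.K2P s)
    + s⁻¹ • (IL.ApKinvP s ⊗ₜ[𝕂] IR.AmK s) - s • (IL.AmKinvP s ⊗ₜ[𝕂] IR.ApK s)

theorem casimirLR_spec (hs : IsGeneric s) :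
    Algebra.TensorProduct.map (IL s).val (IR s).val (casimirLR s) = comul hs (casimir s) := by
  have h := sat s
  have h2 := hs.sub_ne
  have h2' := hs.add_ne
  have hs := hs.ne_zero
  have h4 : s ^ 2 - (s ^ 2)⁻¹ = (s ^ 2 - 1) * (s ^ 2 + 1) / s ^ 2 := by field_simp; ring
  have h5 : s - s⁻¹ = (s ^ 2 - 1) / s := by field_simp
  simp only [casimirLR, map_add, map_sub, map_smul, Algebra.TensorProduct.map_tmul, IL.cas, IR.cas,
    IL.Kinv2P, IL.ApKinvP, IL.AmKinvP, IR.AmK, IR.ApK, IR.K2P, Subalgebra.coe_val, comul]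
  simp only [casimir, map_add, map_sub, map_smul, map_mul, map_pow, map_neg, lift_Ap, lift_Am,
    lift_K, lift_Kinv, lift_P]
  simp only [add_mul, mul_add, sub_mul, mul_sub, mul_assoc, sq, smul_mul_assoc, mul_smul_comm,
    neg_mul, mul_neg, one_mul, mul_one, smul_add, smul_sub, smul_smul, smul_neg, neg_smul, neg_neg,
    h.k_ap, h.k_am, h.ki_ap hs, h.ki_am hs, h.p_ap, h.p_am, h.am_ap, h.p_p, h.P_K, h.P_Kinv,
    h.K_Kinv, h.Kinv_K, lassoc h.k_ap, lassoc h.k_am, lassoc (h.ki_ap hs), lassoc (h.ki_am hs),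
    lassoc h.p_ap, lassoc h.p_am, lassoc h.am_ap, lassoc h.p_p, lassoc h.P_K, lassoc h.P_Kinv,
    lassoc h.K_Kinv, lassoc h.Kinv_K, Algebra.TensorProduct.tmul_mul_tmul, TensorProduct.add_tmul,
    TensorProduct.tmul_add,TensorProduct.sub_tmul, TensorProduct.tmul_sub, ←
    TensorProduct.smul_tmul', TensorProduct.tmul_smul, TensorProduct.neg_tmul,
    TensorProduct.tmul_neg, Algebra.TensorProduct.one_def]
  match_scalars
  all_goals try simp only [← sq, h4, h5]
  all_goals try field_simp
  all_goals try ring1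

theorem comul_IR (hs : IsGeneric s) (x : IR s) :
    comul hs x ∈ (Algebra.TensorProduct.map (AlgHom.id 𝕂 (Osp s)) (IR s).val).range := by
  obtain ⟨x, hx⟩ := x
  have h := sat s
  have h0 := hs.ne_zero
  suffices H : IR s ≤ Subalgebra.comap (comul hs)
      (Algebra.TensorProduct.map (AlgHom.id 𝕂 (Osp s)) (IR s).val).range from H hx
  refine Algebra.adjoin_le ?_
  rintro y (rfl | rfl | rfl | rfl)
  all_goals rw [SetLike.mem_coe, Subalgebra.mem_comap]
  · refine (AlgHom.mem_range _).2 ⟨(Am s * K s) ⊗ₜ IR.K2P s + 1 ⊗ₜ IR.AmK s, ?_⟩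
    simp only [map_add, Algebra.TensorProduct.map_tmul, AlgHom.id_apply,
      IR.AmK, IR.K2P, Subalgebra.coe_val, comul, map_mul, lift_Am, lift_K, add_mul,
      Algebra.TensorProduct.tmul_mul_tmul, h.Kinv_K, mul_assoc, h.P_K, sq]
  · refine (AlgHom.mem_range _).2 ⟨(Ap s * K s) ⊗ₜ IR.K2P s + 1 ⊗ₜ IR.ApK s, ?_⟩
    simp only [map_add, Algebra.TensorProduct.map_tmul, AlgHom.id_apply,
      IR.ApK, IR.K2P, Subalgebra.coe_val, comul, map_mul, lift_Ap, lift_K, add_mul,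
      Algebra.TensorProduct.tmul_mul_tmul, h.Kinv_K, mul_assoc, h.P_K, sq]
  · refine (AlgHom.mem_range _).2 ⟨(K s ^ 2 * P s) ⊗ₜ IR.K2P s, ?_⟩
    simp only [Algebra.TensorProduct.map_tmul, AlgHom.id_apply,
      IR.K2P, Subalgebra.coe_val, comul, map_mul, lift_P, lift_K, sq,
      Algebra.TensorProduct.tmul_mul_tmul]
  · refine (AlgHom.mem_range _).2 ⟨Algebra.TensorProduct.map (IL s).val (AlgHom.id 𝕂 (IR s)) (casimirLR s), ?_⟩
    rw [← casimirLR_spec hs]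
    rw [← AlgHom.comp_apply, ← Algebra.TensorProduct.map_comp]
    rfl

theorem comul_IL (hs : IsGeneric s) (x : IL s) :
    comul hs x ∈ (Algebra.TensorProduct.map (IL s).val (AlgHom.id 𝕂 (Osp s))).range := by
  obtain ⟨x, hx⟩ := x
  have h := sat s
  have h0 := hs.ne_zero
  suffices H : IL s ≤ Subalgebra.comap (comul hs)
      (Algebra.TensorProduct.map (IL s).val (AlgHom.id 𝕂 (Osp s))).range from H hx
  refine Algebra.adjoin_le ?_
  rintro y (rfl | rfl | rfl | rfl)
  all_goals rw [SetLike.mem_coe, Subalgebra.mem_comap]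
  · refine (AlgHom.mem_range _).2 ⟨IL.ApKinvP s ⊗ₜ 1 + IL.Kinv2P s ⊗ₜ (Ap s * Kinv s * P s), ?_⟩
    simp only [map_add, Algebra.TensorProduct.map_tmul, AlgHom.id_apply,
      IL.ApKinvP, IL.Kinv2P, Subalgebra.coe_val, comul, map_mul, lift_Ap, lift_Kinv, lift_P,
      add_mul, Algebra.TensorProduct.tmul_mul_tmul, h.K_Kinv, mul_assoc, h.P_Kinv, sq, lassoc h.P_Kinv, h.p_p,
      mul_one]
  · refine (AlgHom.mem_range _).2 ⟨IL.AmKinvP s ⊗ₜ 1 + IL.Kinv2P s ⊗ₜ (Am s * Kinv s * P s), ?_⟩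
    simp only [map_add, Algebra.TensorProduct.map_tmul, AlgHom.id_apply,
      IL.AmKinvP, IL.Kinv2P, Subalgebra.coe_val, comul, map_mul, lift_Am, lift_Kinv, lift_P,
      add_mul, Algebra.TensorProduct.tmul_mul_tmul, h.K_Kinv, mul_assoc, h.P_Kinv, sq, lassoc h.P_Kinv, h.p_p,
      mul_one]
  · refine (AlgHom.mem_range _).2 ⟨IL.Kinv2P s ⊗ₜ (Kinv s ^ 2 * P s), ?_⟩
    simp only [Algebra.TensorProduct.map_tmul, AlgHom.id_apply,
      IL.Kinv2P, Subalgebra.coe_val, comul, map_mul, lift_P, lift_Kinv, sq,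
      Algebra.TensorProduct.tmul_mul_tmul]
  · refine (AlgHom.mem_range _).2 ⟨Algebra.TensorProduct.map (AlgHom.id 𝕂 (IL s)) (IR s).val (casimirLR s), ?_⟩
    rw [← casimirLR_spec hs]
    rw [← AlgHom.comp_apply, ← Algebra.TensorProduct.map_comp]
    rfl

theorem inclR_injective (s : 𝕂) : Function.Injective
    (Algebra.TensorProduct.map (AlgHom.id 𝕂 (Osp s)) (IR s).val) :=
  Module.Flat.lTensor_preserves_injective_linearMap (M := Osp s) (IR s).val.toLinearMap
    Subtype.val_injective

theorem inclL_injective (s : 𝕂) : Function.Injective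
    (Algebra.TensorProduct.map (IL s).val (AlgHom.id 𝕂 (Osp s))) :=
  Module.Flat.rTensor_preserves_injective_linearMap (M := Osp s) (IL s).val.toLinearMap
    Subtype.val_injective

/-- The coproduct restricted to `I_R`, with values in `osp_q(1|2) ⊗ I_R` (see `comulR_spec`). -/
def comulR (hs : IsGeneric s) : IR s →ₐ[𝕂] Osp s ⊗[𝕂] IR s :=
  ((AlgEquiv.ofInjective _ (inclR_injective s)).symm : _ →ₐ[𝕂] Osp s ⊗[𝕂] IR s).comp
    (((comul hs).comp (IR s).val).codRestrict _ (comul_IR hs))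

theorem comulR_spec (hs : IsGeneric s) (x : IR s) :
    Algebra.TensorProduct.map (AlgHom.id 𝕂 (Osp s)) (IR s).val (comulR hs x) = comul hs x :=
  congrArg Subtype.val ((AlgEquiv.ofInjective _ (inclR_injective s)).apply_symm_apply
    ⟨comul hs x, comul_IR hs x⟩)

/-- The coproduct restricted to `I_L`, with values in `I_L ⊗ osp_q(1|2)` (see `comulL_spec`). -/
def comulL (hs : IsGeneric s) : IL s →ₐ[𝕂] IL s ⊗[𝕂] Osp s :=
  ((AlgEquiv.ofInjective _ (inclL_injective s)).symm : _ →ₐ[𝕂] IL s ⊗[𝕂] Osp s).comp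
    (((comul hs).comp (IL s).val).codRestrict _ (comul_IL hs))

theorem comulL_spec (hs : IsGeneric s) (x : IL s) :
    Algebra.TensorProduct.map (IL s).val (AlgHom.id 𝕂 (Osp s)) (comulL hs x) = comul hs x :=
  congrArg Subtype.val ((AlgEquiv.ofInjective _ (inclL_injective s)).apply_symm_apply
    ⟨comul hs x, comul_IL hs x⟩)

/-- The `n`-fold tensor power `osp_q(1|2)^{⊗n}`. Tensor positions `1, …, n` are labelled by `Fin n`. -/
abbrev Pow (s : 𝕂) (n : ℕ) : Type _ := ⨂[𝕂] _ : Fin n, Osp s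

/-- `1 ⊗ ⋯ ⊗ h ⊗ ⋯ ⊗ 1` with `h` in position `p`. -/
def leg (s : 𝕂) {n : ℕ} (p : Fin n) : Osp s →ₐ[𝕂] Pow s n :=
  PiTensorProduct.singleAlgHom (A := fun _ : Fin n => Osp s) p

/-- `w ⊗ h ↦ w · (h in position p)`: for `w` with `1` in position `p` and beyond, this puts the last
tensor factor `h` into position `p`. -/
def insertR {n : ℕ} (p : Fin n) : Pow s n ⊗[𝕂] Osp s →ₗ[𝕂] Pow s n :=
  LinearMap.mul' 𝕂 (Pow s n) ∘ₗ LinearMap.lTensor (Pow s n) (leg s p).toLinearMap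

/-- `h ⊗ w ↦ (h in position p) · w`: for `w` with `1` in position `p` and before, this puts the first
tensor factor `h` into position `p`. -/
def insertL {n : ℕ} (p : Fin n) : Osp s ⊗[𝕂] Pow s n →ₗ[𝕂] Pow s n :=
  LinearMap.mul' 𝕂 (Pow s n) ∘ₗ LinearMap.rTensor (Pow s n) (leg s p).toLinearMap

/-- One application of `1 ⊗ ⋯ ⊗ 1 ⊗ φ`, where `φ` is `Δ` or `τ_R`, to the last tensor factor. That factor
lies in `I_R` and sits in position `p`; the earlier positions (and `1`s in the unused ones) are
recorded in `osp_q(1|2)^{⊗n}`. Writing `φ(x) = ∑ x' ⊗ x''`, the factor `x'` goes to position `p`, and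
`x''` is the new last factor, in position `p + 1`. -/
def stepR {n : ℕ} (φ : IR s →ₐ[𝕂] Osp s ⊗[𝕂] IR s) (p : Fin n) :
    Pow s n ⊗[𝕂] IR s →ₗ[𝕂] Pow s n ⊗[𝕂] IR s :=
  LinearMap.rTensor (IR s) (insertR p) ∘ₗ
    (TensorProduct.assoc 𝕂 (Pow s n) (Osp s) (IR s)).symm.toLinearMap ∘ₗ
      LinearMap.lTensor (Pow s n) φ.toLinearMap

/-- One application of `φ ⊗ 1 ⊗ ⋯ ⊗ 1`, where `φ` is `Δ` or `τ_L`, to the first tensor factor. That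
factor lies in `I_L` and sits in position `p`. Writing `φ(x) = ∑ x' ⊗ x''`, the factor `x''` goes to
position `p`, and `x'` is the new first factor, in position `p - 1`. -/
def stepL {n : ℕ} (φ : IL s →ₐ[𝕂] IL s ⊗[𝕂] Osp s) (p : Fin n) :
    IL s ⊗[𝕂] Pow s n →ₗ[𝕂] IL s ⊗[𝕂] Pow s n :=
  LinearMap.lTensor (IL s) (insertL p) ∘ₗ
    (TensorProduct.assoc 𝕂 (IL s) (Osp s) (Pow s n)).toLinearMap ∘ₗ
      LinearMap.rTensor (Pow s n) φ.toLinearMap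

theorem stepR_tmul {n : ℕ} (φ : IR s →ₐ[𝕂] Osp s ⊗[𝕂] IR s) (p : Fin n) (w : Pow s n) (x : IR s)
    (h : Osp s) (y : IR s) (hx : φ x = h ⊗ₜ y) :
    stepR φ p (w ⊗ₜ x) = (w * leg s p h) ⊗ₜ y := by
  simp [stepR, insertR, hx]

theorem stepL_tmul {n : ℕ} (φ : IL s →ₐ[𝕂] IL s ⊗[𝕂] Osp s) (p : Fin n) (w : Pow s n) (x : IL s)
    (h : Osp s) (y : IL s) (hx : φ x = y ⊗ₜ h) :
    stepL φ p (x ⊗ₜ w) = y ⊗ₜ (leg s p h * w) := by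
  simp [stepL, insertL, hx]

/-- The steps of the right extension process at the positions `p ∈ I`, in increasing order: `Δ` if
`p ∈ A`, and `τ_R` (which creates a hole) if `p ∉ A`. Here `I` is an interval of positions that ends
just before `max A`; afterwards the last tensor factor is in position `max A`. -/
def runR (hs : IsGeneric s) {n : ℕ} (A : Finset (Fin n)) (hA : A.Nonempty)
    (I : Finset (Fin n)) : Pow s n ⊗[𝕂] IR s →ₗ[𝕂] Pow s n :=
  insertR (A.max' hA) ∘ₗ LinearMap.lTensor (Pow s n) (IR s).val.toLinearMap ∘ₗ
    (I.sort (· ≤ ·)).foldl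
      (fun f p => stepR (if p ∈ A then comulR hs else tauR hs) p ∘ₗ f) LinearMap.id

/-- The steps of the left extension process at the positions `p ∈ I`, in decreasing order: `Δ` if
`p ∈ A`, and `τ_L` (which creates a hole) if `p ∉ A`. Here `I` is an interval of positions that begins
just after `min A`; afterwards the first tensor factor is in position `min A`. -/
def runL (hs : IsGeneric s) {n : ℕ} (A : Finset (Fin n)) (hA : A.Nonempty)
    (I : Finset (Fin n)) : IL s ⊗[𝕂] Pow s n →ₗ[𝕂] Pow s n :=
  insertL (A.min' hA) ∘ₗ LinearMap.rTensor (Pow s n) (IL s).val.toLinearMap ∘ₗ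
    (I.sort (· ≥ ·)).foldl
      (fun f p => stepL (if p ∈ A then comulL hs else tauL hs) p ∘ₗ f) LinearMap.id

/-- The right extension process: start with `Γ^q` in position `min A` and work up to `max A`. -/
def gammaRight (hs : IsGeneric s) {n : ℕ} (A : Finset (Fin n)) (hA : A.Nonempty) : Pow s n :=
  runR hs A hA (Finset.Ico (A.min' hA) (A.max' hA)) (1 ⊗ₜ IR.cas s)

/-- The left extension process: start with `Γ^q` in position `max A` and work down to `min A`. -/
def gammaLeft (hs : IsGeneric s) {n : ℕ} (A : Finset (Fin n)) (hA : A.Nonempty) : Pow s n :=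
  runL hs A hA (Finset.Ioc (A.min' hA) (A.max' hA)) (IL.cas s ⊗ₜ 1)

/-- The mixed extension process that splits `A` at `j ∈ A`, `j ≠ max A`: start with `Γ^q` in position
`j`; its first step is `Δ` at `j`, which puts `Δ(Γ^q) ∈ I_L ⊗ I_R` in positions `j, j + 1`; continue
the right extension process from position `j + 1` up to `max A`, and then run the left extension
process from position `j` down to `min A`. -/
def gammaMixed (hs : IsGeneric s) {n : ℕ} (A : Finset (Fin n)) (hA : A.Nonempty) (j : Fin n) :
    Pow s n :=
  runL hs A hA (Finset.Ioc (A.min' hA) j)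
    (LinearMap.lTensor (IL s)
      (runR hs A hA (Finset.Ioo j (A.max' hA)) ∘ₗ TensorProduct.mk 𝕂 (Pow s n) (IR s) 1)
      (casimirLR s))

/-- `IsGamma hs A x`: the element `x` of `osp_q(1|2)^{⊗n}` is the generator `Γ^q_A`, as constructed by
the right, the left or any of the mixed extension processes (splitting at `max A` is the left
process). For the empty set it is the scalar `-1 / (q^{1/2} + q^{-1/2})`. -/
inductive IsGamma (hs : IsGeneric s) {n : ℕ} : Finset (Fin n) → Pow s n → Prop
  | empty : IsGamma hs ∅ (algebraMap 𝕂 (Pow s n) ((s⁻¹ - s) / (s ^ 2 - (s ^ 2)⁻¹)))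
  | right (A : Finset (Fin n)) (hA : A.Nonempty) : IsGamma hs A (gammaRight hs A hA)
  | left (A : Finset (Fin n)) (hA : A.Nonempty) : IsGamma hs A (gammaLeft hs A hA)
  | mixed (A : Finset (Fin n)) (hA : A.Nonempty) (j : Fin n) (hj : j ∈ A) (hj' : j ≠ A.max' hA) :
      IsGamma hs A (gammaMixed hs A hA j)

end Osp

end

end QBannaiIto

set_option linter.unusedSimpArgs false

namespace QBannaiIto
namespace Osp

variable {𝕂 : Type*} [Field 𝕂] {s : 𝕂}

/-! Write `U` for `osp_q(1|2)` and `Γ` for its Casimir element. Two facts carry the theorem.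

All processes for `A` give the same element. Each process, started in position `p`, is an algebra
morphism: `extR` on `I_R`, `extL` on `I_L`. Indeed every step multiplies images that sit in disjoint
tensor positions, and these commute. Apply to `Δ(Γ) ∈ I_L ⊗ I_R` the left extension from `p` on the
first factor and the right extension from `p + 1` on the second. The result does not depend on `p`,
because `(1 ⊗ Δ)Δ(Γ) = (Δ ⊗ 1)Δ(Γ)` (`comulR_comulL`) and `(1 ⊗ τ_R)Δ(Γ) = (τ_L ⊗ 1)Δ(Γ)`
(`tauR_tauL`) move the splitting point by one position. The right, left and mixed processes only
differ in the choice of this point, so all equal `extR` from `min A` at `Γ` (`IsGamma.eq_extR`).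

Commutation needs a stronger statement that survives induction on the position. Let `f` and `g` be
the right extensions of `A` and of `B ⊆ A` from a common position. `Exchange` lists, for generators
`x`, `y` of `I_R`, how to rewrite `f(x) g(y)` through products `g(·) f(·)`. This list is closed
under prepending a position: if it holds for `f`, `g`, it holds after applying (`Δ`, `Δ`), (`Δ`,
`τ_R`) or (`τ_R`, `τ_R`) and gluing. The fourth pair (`τ_R`, `Δ`) would mean `p ∈ B`, `p ∉ A`.

The induction starts just beyond `max B`. Since `(id ⊗ ε)Δ = id`, the extension of `B` may be
continued there by the counit `ε`, and `ε` satisfies the list against every `f`, thanks to the value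
`ε(Γ) = -1/(q^{1/2} + q^{-1/2})`. Descending to `min B`, four of the relations say that `g(Γ) = Γ_B`
commutes with the images of all generators under `f`, hence with the whole image of `f`. Further
down only positions `< min B` are added to the process of `A`, and `Γ_B` has nothing there; so `Γ_A`
commutes with `Γ_B`. -/

/-! ### Exchange relations and their stability under `Δ` and `τ_R` -/

/-- The exchange relations between two extensions `(Xa, Xb, Xc, Xg)` and `(ya, yb, yc, yg)` of the
generators `A₋K, A₊K, K²P, Γ^q` of `I_R`. They are the relations between `Δ(x)` and `y ⊗ 1`, for `x`
and `y` among these generators. -/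
structure Exchange {R : Type*} [Ring R] [Algebra 𝕂 R] (s : 𝕂)
    (Xa Xb Xc Xg ya yb yc yg : R) : Prop where
  a_a : Xa * ya = ya * Xa
  a_b : Xa * yb = yb * Xa + yc * Xc + (s + s⁻¹) • (yg * Xc)
  a_c : Xa * yc = yc * Xa + (1 + (s ^ 2)⁻¹) • (ya * Xc)
  a_g : Xa * yg = yg * Xa
  b_a : Xb * ya = ya * Xb - yc * Xc - (s + s⁻¹) • (yg * Xc)
  b_b : Xb * yb = yb * Xb
  b_c : Xb * yc = yc * Xb + (1 + s ^ 2) • (yb * Xc)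
  b_g : Xb * yg = yg * Xb
  c_a : Xc * ya = -((s ^ 2)⁻¹ • (ya * Xc))
  c_b : Xc * yb = -(s ^ 2 • (yb * Xc))
  c_c : Xc * yc = yc * Xc
  c_g : Xc * yg = yg * Xc
  g_a : Xg * ya = s⁻¹ • (ya * Xc) - s ^ 2 • (ya * Xg) + s • (yc * Xa) + (1 + s ^ 2) • (yg * Xa)
  g_b : Xg * yb = s • (yb * Xc) - (s ^ 2)⁻¹ • (yb * Xg) + s⁻¹ • (yc * Xb)
    + (1 + (s ^ 2)⁻¹) • (yg * Xb)
  g_c : Xg * yc = yc * Xg + (s + s⁻¹) • (yb * Xa - ya * Xb + yc * Xc)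
    + (s + s⁻¹) ^ 2 • (yg * Xc)
  g_g : Xg * yg = yg * Xg

namespace Exchange

variable {R : Type*} [Ring R] [Algebra 𝕂 R] {Xa Xb Xc Xg ya yb yc yg : R}

/-- The counit values `(0, 0, 1, ε(Γ^q))` satisfy the exchange relations with everything. -/
theorem counit (hs : IsGeneric s) (Xa Xb Xc Xg : R) :
    Exchange s Xa Xb Xc Xg 0 0 1 (algebraMap 𝕂 R ((s⁻¹ - s) / (s ^ 2 - (s ^ 2)⁻¹))) := by
  have h0 := hs.ne_zero
  have h2 := hs.sub_ne
  have h2' := hs.add_ne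
  -- The factors `s ^ 2 ± 1` are nonzero by genericity, so in this form the denominators can be
  -- cleared.
  have h4 : s ^ 2 - (s ^ 2)⁻¹ = (s ^ 2 - 1) * (s ^ 2 + 1) / s ^ 2 := by field_simp; ring
  rw [Algebra.algebraMap_eq_smul_one]
  constructor
  all_goals
    simp only [mul_zero, zero_mul, mul_one, one_mul, smul_zero, smul_mul_assoc, mul_smul_comm,
      neg_zero, h4, sub_zero, zero_sub]
  -- The scalar equals `-1 / (s + s⁻¹)`. With `yc = 1` this makes the `yc` and `yg` terms cancel in
  -- `a_b`, `b_a`, `g_a`, `g_b`, and the `yc * Xc` and `yg * Xc` terms in `g_c`.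
  all_goals match_scalars
  all_goals try field_simp
  all_goals try ring1

set_option maxHeartbeats 4000000 in
/-- The exchange relations are preserved when `Δ` is applied to both extensions. -/
theorem comul_comul (r : Exchange s Xa Xb Xc Xg ya yb yc yg) (hs : IsGeneric s) :
    Exchange s ((Am s * K s) ⊗ₜ[𝕂] Xc + (1 : Osp s) ⊗ₜ[𝕂] Xa)
      ((Ap s * K s) ⊗ₜ[𝕂] Xc + (1 : Osp s) ⊗ₜ[𝕂] Xb)
      ((K s ^ 2 * P s) ⊗ₜ[𝕂] Xc)
      (casimir s ⊗ₜ[𝕂] Xc + (Kinv s ^ 2 * P s) ⊗ₜ[𝕂] Xg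
        + ((s - s⁻¹) / (s ^ 2 - (s ^ 2)⁻¹)) • ((Kinv s ^ 2 * P s) ⊗ₜ[𝕂] Xc)
        + s⁻¹ • ((Ap s * Kinv s * P s) ⊗ₜ[𝕂] Xa) - s • ((Am s * Kinv s * P s) ⊗ₜ[𝕂] Xb))
      ((Am s * K s) ⊗ₜ[𝕂] yc + (1 : Osp s) ⊗ₜ[𝕂] ya)
      ((Ap s * K s) ⊗ₜ[𝕂] yc + (1 : Osp s) ⊗ₜ[𝕂] yb)
      ((K s ^ 2 * P s) ⊗ₜ[𝕂] yc)
      (casimir s ⊗ₜ[𝕂] yc + (Kinv s ^ 2 * P s) ⊗ₜ[𝕂] yg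
        + ((s - s⁻¹) / (s ^ 2 - (s ^ 2)⁻¹)) • ((Kinv s ^ 2 * P s) ⊗ₜ[𝕂] yc)
        + s⁻¹ • ((Ap s * Kinv s * P s) ⊗ₜ[𝕂] ya) - s • ((Am s * Kinv s * P s) ⊗ₜ[𝕂] yb)) := by
  have h := sat s
  have h2 := hs.sub_ne
  have h2' := hs.add_ne
  have hs := hs.ne_zero
  have h4 : s ^ 2 - (s ^ 2)⁻¹ = (s ^ 2 - 1) * (s ^ 2 + 1) / s ^ 2 := by field_simp; ring
  have h5 : s - s⁻¹ = (s ^ 2 - 1) / s := by field_simp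
  constructor
  all_goals
    try simp only [casimir, h4, h5]
    -- Normal ordering of both tensor factors: the first is sorted as `A₊`, `A₋`, powers of `K`,
    -- `P`, and in the second the hypotheses `r` move each `y` to the left of each `X`. What remains
    -- is a comparison of coefficients in `𝕂`.
    simp only [add_mul, mul_add, sub_mul, mul_sub, mul_assoc, sq, smul_mul_assoc, mul_smul_comm,
      neg_mul, mul_neg, one_mul, mul_one, smul_add, smul_sub, smul_smul, smul_neg, neg_smul,
      neg_neg, h.k_ap, h.k_am, h.ki_ap hs, h.ki_am hs, h.p_ap, h.p_am, h.am_ap, h.p_p, h.P_K,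
      h.P_Kinv, h.K_Kinv, h.Kinv_K, lassoc h.k_ap, lassoc h.k_am, lassoc (h.ki_ap hs), lassoc
      (h.ki_am hs), lassoc h.p_ap, lassoc h.p_am, lassoc h.am_ap, lassoc h.p_p, lassoc h.P_K, lassoc
      h.P_Kinv, lassoc h.K_Kinv, lassoc h.Kinv_K, r.a_a, r.a_b, r.a_c, r.a_g, r.b_a, r.b_b, r.b_c,
      r.b_g, r.c_a, r.c_b, r.c_c, r.c_g, r.g_a, r.g_b, r.g_c, r.g_g,
      Algebra.TensorProduct.tmul_mul_tmul, TensorProduct.add_tmul, TensorProduct.tmul_add,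
      TensorProduct.sub_tmul, TensorProduct.tmul_sub, ← TensorProduct.smul_tmul',
      TensorProduct.tmul_smul, TensorProduct.neg_tmul, TensorProduct.tmul_neg]
    try match_scalars
    all_goals try simp only [← sq, h4, h5]
    all_goals try field_simp
    all_goals try ring1

set_option maxHeartbeats 4000000 in
/-- The exchange relations are preserved when `Δ` is applied to the first extension and `τ_R` to
the second one. -/
theorem comul_tau (r : Exchange s Xa Xb Xc Xg ya yb yc yg) (hs : IsGeneric s) :
    Exchange s ((Am s * K s) ⊗ₜ[𝕂] Xc + (1 : Osp s) ⊗ₜ[𝕂] Xa)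
      ((Ap s * K s) ⊗ₜ[𝕂] Xc + (1 : Osp s) ⊗ₜ[𝕂] Xb)
      ((K s ^ 2 * P s) ⊗ₜ[𝕂] Xc)
      (casimir s ⊗ₜ[𝕂] Xc + (Kinv s ^ 2 * P s) ⊗ₜ[𝕂] Xg
        + ((s - s⁻¹) / (s ^ 2 - (s ^ 2)⁻¹)) • ((Kinv s ^ 2 * P s) ⊗ₜ[𝕂] Xc)
        + s⁻¹ • ((Ap s * Kinv s * P s) ⊗ₜ[𝕂] Xa) - s • ((Am s * Kinv s * P s) ⊗ₜ[𝕂] Xb))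
      ((K s ^ 2 * P s) ⊗ₜ[𝕂] ya)
      ((Kinv s ^ 2 * P s) ⊗ₜ[𝕂] yb + (s⁻¹ * (s ^ 2 - (s ^ 2)⁻¹)) • ((Ap s ^ 2 * P s) ⊗ₜ[𝕂] ya)
        + (s⁻¹ * (s - s⁻¹)) • ((Ap s * Kinv s * P s) ⊗ₜ[𝕂] yc)
        + (s⁻¹ * (s ^ 2 - (s ^ 2)⁻¹)) • ((Ap s * Kinv s * P s) ⊗ₜ[𝕂] yg))
      ((1 : Osp s) ⊗ₜ[𝕂] yc - (s ^ 2 - (s ^ 2)⁻¹) • ((Ap s * K s) ⊗ₜ[𝕂] ya))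
      ((1 : Osp s) ⊗ₜ[𝕂] yg) := by
  have h := sat s
  have h2 := hs.sub_ne
  have h2' := hs.add_ne
  have hs := hs.ne_zero
  have h4 : s ^ 2 - (s ^ 2)⁻¹ = (s ^ 2 - 1) * (s ^ 2 + 1) / s ^ 2 := by field_simp; ring
  have h5 : s - s⁻¹ = (s ^ 2 - 1) / s := by field_simp
  constructor
  all_goals
    try simp only [casimir, h4, h5]
    simp only [add_mul, mul_add, sub_mul, mul_sub, mul_assoc, sq, smul_mul_assoc, mul_smul_comm,
      neg_mul, mul_neg, one_mul, mul_one, smul_add, smul_sub, smul_smul, smul_neg, neg_smul,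
      neg_neg, h.k_ap, h.k_am, h.ki_ap hs, h.ki_am hs, h.p_ap, h.p_am, h.am_ap, h.p_p, h.P_K,
      h.P_Kinv, h.K_Kinv, h.Kinv_K, lassoc h.k_ap, lassoc h.k_am, lassoc (h.ki_ap hs), lassoc
      (h.ki_am hs), lassoc h.p_ap, lassoc h.p_am, lassoc h.am_ap, lassoc h.p_p, lassoc h.P_K, lassoc
      h.P_Kinv, lassoc h.K_Kinv, lassoc h.Kinv_K, r.a_a, r.a_b, r.a_c, r.a_g, r.b_a, r.b_b, r.b_c,
      r.b_g, r.c_a, r.c_b, r.c_c, r.c_g, r.g_a, r.g_b, r.g_c, r.g_g,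
      Algebra.TensorProduct.tmul_mul_tmul, TensorProduct.add_tmul, TensorProduct.tmul_add,
      TensorProduct.sub_tmul, TensorProduct.tmul_sub, ← TensorProduct.smul_tmul',
      TensorProduct.tmul_smul, TensorProduct.neg_tmul, TensorProduct.tmul_neg]
    try match_scalars
    all_goals try simp only [← sq, h4, h5]
    all_goals try field_simp
    all_goals try ring1

set_option maxHeartbeats 4000000 in
/-- The exchange relations are preserved when `τ_R` is applied to both extensions. -/
theorem tau_tau (r : Exchange s Xa Xb Xc Xg ya yb yc yg) (hs : IsGeneric s) :
    Exchange s ((K s ^ 2 * P s) ⊗ₜ[𝕂] Xa)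
      ((Kinv s ^ 2 * P s) ⊗ₜ[𝕂] Xb + (s⁻¹ * (s ^ 2 - (s ^ 2)⁻¹)) • ((Ap s ^ 2 * P s) ⊗ₜ[𝕂] Xa)
        + (s⁻¹ * (s - s⁻¹)) • ((Ap s * Kinv s * P s) ⊗ₜ[𝕂] Xc)
        + (s⁻¹ * (s ^ 2 - (s ^ 2)⁻¹)) • ((Ap s * Kinv s * P s) ⊗ₜ[𝕂] Xg))
      ((1 : Osp s) ⊗ₜ[𝕂] Xc - (s ^ 2 - (s ^ 2)⁻¹) • ((Ap s * K s) ⊗ₜ[𝕂] Xa))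
      ((1 : Osp s) ⊗ₜ[𝕂] Xg)
      ((K s ^ 2 * P s) ⊗ₜ[𝕂] ya)
      ((Kinv s ^ 2 * P s) ⊗ₜ[𝕂] yb + (s⁻¹ * (s ^ 2 - (s ^ 2)⁻¹)) • ((Ap s ^ 2 * P s) ⊗ₜ[𝕂] ya)
        + (s⁻¹ * (s - s⁻¹)) • ((Ap s * Kinv s * P s) ⊗ₜ[𝕂] yc)
        + (s⁻¹ * (s ^ 2 - (s ^ 2)⁻¹)) • ((Ap s * Kinv s * P s) ⊗ₜ[𝕂] yg))
      ((1 : Osp s) ⊗ₜ[𝕂] yc - (s ^ 2 - (s ^ 2)⁻¹) • ((Ap s * K s) ⊗ₜ[𝕂] ya))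
      ((1 : Osp s) ⊗ₜ[𝕂] yg) := by
  have h := sat s
  have h2 := hs.sub_ne
  have h2' := hs.add_ne
  have hs := hs.ne_zero
  have h4 : s ^ 2 - (s ^ 2)⁻¹ = (s ^ 2 - 1) * (s ^ 2 + 1) / s ^ 2 := by field_simp; ring
  have h5 : s - s⁻¹ = (s ^ 2 - 1) / s := by field_simp
  constructor
  all_goals
    try simp only [h4, h5]
    simp only [add_mul, mul_add, sub_mul, mul_sub, mul_assoc, sq, smul_mul_assoc, mul_smul_comm,
      neg_mul, mul_neg, one_mul, mul_one, smul_add, smul_sub, smul_smul, smul_neg, neg_smul,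
      neg_neg, h.k_ap, h.k_am, h.ki_ap hs, h.ki_am hs, h.p_ap, h.p_am, h.am_ap, h.p_p, h.P_K,
      h.P_Kinv, h.K_Kinv, h.Kinv_K, lassoc h.k_ap, lassoc h.k_am, lassoc (h.ki_ap hs), lassoc
      (h.ki_am hs), lassoc h.p_ap, lassoc h.p_am, lassoc h.am_ap, lassoc h.p_p, lassoc h.P_K, lassoc
      h.P_Kinv, lassoc h.K_Kinv, lassoc h.Kinv_K, r.a_a, r.a_b, r.a_c, r.a_g, r.b_a, r.b_b, r.b_c,
      r.b_g, r.c_a, r.c_b, r.c_c, r.c_g, r.g_a, r.g_b, r.g_c, r.g_g,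
      Algebra.TensorProduct.tmul_mul_tmul, TensorProduct.add_tmul, TensorProduct.tmul_add,
      TensorProduct.sub_tmul, TensorProduct.tmul_sub, ← TensorProduct.smul_tmul',
      TensorProduct.tmul_smul, TensorProduct.neg_tmul, TensorProduct.tmul_neg]
    try match_scalars
    all_goals try simp only [← sq, h4, h5]
    all_goals try field_simp
    all_goals try ring1

end Exchange
-- The extension processes as algebra morphisms
theorem leg_commute {n : ℕ} {p q : Fin n} (hpq : p ≠ q) (u v : Osp s) :
    Commute (leg s p u) (leg s q v) := by
  simp only [Commute, SemiconjBy, leg, PiTensorProduct.singleAlgHom_apply,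
    PiTensorProduct.tprod_mul_tprod]
  congr 1
  funext i
  rcases eq_or_ne i p with rfl | hi
  · simp [Pi.mulSingle_eq_of_ne hpq]
  · simp [Pi.mulSingle_eq_of_ne hi]

/-- The first element of the list gives the innermost factor of the composition. Splitting it off
allows induction from the front of the list, that is, from the first step of the process. -/
theorem foldl_comp {ι M : Type*} [AddCommMonoid M] [Module 𝕂 M] (F : ι → M →ₗ[𝕂] M) (l : List ι)
    (g : M →ₗ[𝕂] M) : l.foldl (fun f p => F p ∘ₗ f) g =
      l.foldl (fun f p => F p ∘ₗ f) LinearMap.id ∘ₗ g := by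
  induction l generalizing g with
  | nil => rfl
  | cons q l ih =>
    rw [List.foldl_cons, ih, List.foldl_cons, ih (_ ∘ₗ LinearMap.id)]
    rfl

/-- Here `g` stands for all the later steps together. The earlier positions, recorded in `w`, stay a
left multiplier, so one more step in front only replaces `f` by `φ` followed by `u ⊗ y ↦ leg u * f
y`. -/
theorem comp_stepR {n : ℕ} (g : Pow s n ⊗[𝕂] IR s →ₗ[𝕂] Pow s n) (f : IR s →ₗ[𝕂] Pow s n)
    (hg : ∀ w x, g (w ⊗ₜ x) = w * f x) (φ : IR s →ₐ[𝕂] Osp s ⊗[𝕂] IR s) (p : Fin n)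
    (w : Pow s n) (x : IR s) : g (stepR φ p (w ⊗ₜ x)) =
      w * LinearMap.mul' 𝕂 (Pow s n) (TensorProduct.map (leg s p).toLinearMap f (φ x)) := by
  rw [stepR, LinearMap.comp_apply, LinearMap.comp_apply, LinearMap.lTensor_tmul,
    AlgHom.toLinearMap_apply]
  induction φ x using TensorProduct.induction_on with
  | zero => simp only [TensorProduct.tmul_zero, LinearMap.map_zero, mul_zero]
  | tmul u y =>
    rw [LinearEquiv.coe_coe, TensorProduct.assoc_symm_tmul, LinearMap.rTensor_tmul, hg]
    simp [insertR, mul_assoc]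
  | add a b ha hb => simp only [TensorProduct.tmul_add, LinearMap.map_add, mul_add, ha, hb]

theorem comp_stepL {n : ℕ} (g : IL s ⊗[𝕂] Pow s n →ₗ[𝕂] Pow s n) (f : IL s →ₗ[𝕂] Pow s n)
    (hg : ∀ w x, g (x ⊗ₜ w) = f x * w) (φ : IL s →ₐ[𝕂] IL s ⊗[𝕂] Osp s) (p : Fin n)
    (w : Pow s n) (x : IL s) : g (stepL φ p (x ⊗ₜ w)) =
      LinearMap.mul' 𝕂 (Pow s n) (TensorProduct.map f (leg s p).toLinearMap (φ x)) * w := by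
  rw [stepL, LinearMap.comp_apply, LinearMap.comp_apply, LinearMap.rTensor_tmul,
    AlgHom.toLinearMap_apply]
  induction φ x using TensorProduct.induction_on with
  | zero => simp only [TensorProduct.zero_tmul, LinearMap.map_zero, zero_mul]
  | tmul y u =>
    rw [LinearEquiv.coe_coe, TensorProduct.assoc_tmul, LinearMap.lTensor_tmul, hg]
    simp [insertL, mul_assoc]
  | add a b ha hb => simp only [TensorProduct.add_tmul, LinearMap.map_add, add_mul, ha, hb]

/-- The steps are built as linear maps; commuting images turn the glued map into an algebra
morphism. -/
theorem mul'_map_eq_lift {X Y R : Type*} [Ring X] [Algebra 𝕂 X] [Ring Y] [Algebra 𝕂 Y] [Ring R]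
    [Algebra 𝕂 R] (f : X →ₐ[𝕂] R) (g : Y →ₐ[𝕂] R) (h : ∀ x y, Commute (f x) (g y)) (t : X ⊗[𝕂] Y) :
    LinearMap.mul' 𝕂 R (TensorProduct.map f.toLinearMap g.toLinearMap t) =
      Algebra.TensorProduct.lift f g h t := by
  induction t using TensorProduct.induction_on with
  | zero => simp only [map_zero]
  | tmul x y => simp
  | add a b ha hb => simp only [map_add, ha, hb]

/-- The clause on `z` says that the image of `f` is built from the positions in `l` and `m` only. It
is carried along because the induction needs it: the position prepended next must commute with this
image for the glued map to be multiplicative. -/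
theorem exists_foldl_stepR {n : ℕ} (c : Fin n → IR s →ₐ[𝕂] Osp s ⊗[𝕂] IR s) (m : Fin n)
    (l : List (Fin n)) (hm : m ∉ l) (hl : l.Nodup) :
    ∃ f : IR s →ₐ[𝕂] Pow s n,
      (∀ w x, insertR m (LinearMap.lTensor (Pow s n) (IR s).val.toLinearMap
        (l.foldl (fun f p => stepR (c p) p ∘ₗ f) LinearMap.id (w ⊗ₜ x))) = w * f x) ∧
      ∀ z, (∀ q, q = m ∨ q ∈ l → ∀ u, Commute (leg s q u) z) → ∀ x, Commute (f x) z := by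
  induction l with
  | nil =>
    exact ⟨(leg s m).comp (IR s).val, fun w x => by simp [insertR], fun z hz x => hz m (.inl rfl) _⟩
  | cons p l ih =>
    rw [List.mem_cons, not_or] at hm
    rw [List.nodup_cons] at hl
    obtain ⟨f, hf, hc⟩ := ih hm.2 hl.2
    -- By `hm` and `hl`, the position `p` differs from `m` and from every position still to be
    -- processed.
    have hpf : ∀ u x, Commute (leg s p u) (f x) := fun u x => by
      refine (hc _ (fun q hq v => leg_commute ?_ _ _) x).symm
      rintro rfl
      rcases hq with h | h
      exacts [hm.1 h.symm, hl.1 h]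
    refine ⟨(Algebra.TensorProduct.lift (leg s p) f hpf).comp (c p), fun w x => ?_,
      fun z hz x => ?_⟩
    · rw [List.foldl_cons, foldl_comp, LinearMap.comp_id, LinearMap.comp_apply]
      refine (comp_stepR (insertR m ∘ₗ LinearMap.lTensor (Pow s n) (IR s).val.toLinearMap ∘ₗ
        l.foldl (fun f p => stepR (c p) p ∘ₗ f) LinearMap.id) f.toLinearMap hf (c p) p w x).trans ?_
      rw [AlgHom.comp_apply, mul'_map_eq_lift]
    · rw [AlgHom.comp_apply]
      induction c p x using TensorProduct.induction_on with
      | zero => rw [map_zero]; exact Commute.zero_left z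
      | tmul u y =>
        rw [Algebra.TensorProduct.lift_tmul]
        refine Commute.mul_left (hz p (.inr (by simp)) u) (hc z (fun q hq => hz q ?_) y)
        exact hq.imp id fun h => List.mem_cons_of_mem p h
      | add a b ha hb => rw [map_add]; exact ha.add_left hb

theorem exists_foldl_stepL {n : ℕ} (c : Fin n → IL s →ₐ[𝕂] IL s ⊗[𝕂] Osp s) (m : Fin n)
    (l : List (Fin n)) (hm : m ∉ l) (hl : l.Nodup) :
    ∃ f : IL s →ₐ[𝕂] Pow s n,
      (∀ w x, insertL m (LinearMap.rTensor (Pow s n) (IL s).val.toLinearMap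
        (l.foldl (fun f p => stepL (c p) p ∘ₗ f) LinearMap.id (x ⊗ₜ w))) = f x * w) ∧
      ∀ z, (∀ q, q = m ∨ q ∈ l → ∀ u, Commute (leg s q u) z) → ∀ x, Commute (f x) z := by
  induction l with
  | nil =>
    exact ⟨(leg s m).comp (IL s).val, fun w x => by simp [insertL], fun z hz x => hz m (.inl rfl) _⟩
  | cons p l ih =>
    rw [List.mem_cons, not_or] at hm
    rw [List.nodup_cons] at hl
    obtain ⟨f, hf, hc⟩ := ih hm.2 hl.2
    have hpf : ∀ x u, Commute (f x) (leg s p u) := fun x u => by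
      refine hc _ (fun q hq v => leg_commute ?_ _ _) x
      rintro rfl
      rcases hq with h | h
      exacts [hm.1 h.symm, hl.1 h]
    refine ⟨(Algebra.TensorProduct.lift f (leg s p) hpf).comp (c p), fun w x => ?_,
      fun z hz x => ?_⟩
    · rw [List.foldl_cons, foldl_comp, LinearMap.comp_id, LinearMap.comp_apply]
      refine (comp_stepL (insertL m ∘ₗ LinearMap.rTensor (Pow s n) (IL s).val.toLinearMap ∘ₗ
        l.foldl (fun f p => stepL (c p) p ∘ₗ f) LinearMap.id) f.toLinearMap hf (c p) p w x).trans ?_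
      rw [AlgHom.comp_apply, mul'_map_eq_lift]
    · rw [AlgHom.comp_apply]
      induction c p x using TensorProduct.induction_on with
      | zero => rw [map_zero]; exact Commute.zero_left z
      | tmul y u =>
        rw [Algebra.TensorProduct.lift_tmul]
        refine Commute.mul_left (hc z (fun q hq => hz q ?_) y) (hz p (.inr (by simp)) u)
        exact hq.imp id fun h => List.mem_cons_of_mem p h
      | add a b ha hb => rw [map_add]; exact ha.add_left hb

/-- The coaction used by the right extension process of `A` at the position `p`. -/
noncomputable def coactR (hs : IsGeneric s) {n : ℕ} (A : Finset (Fin n)) (p : Fin n) :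
    IR s →ₐ[𝕂] Osp s ⊗[𝕂] IR s :=
  if p ∈ A then comulR hs else tauR hs

/-- The coaction used by the left extension process of `A` at the position `p`. -/
noncomputable def coactL (hs : IsGeneric s) {n : ℕ} (A : Finset (Fin n)) (p : Fin n) :
    IL s →ₐ[𝕂] IL s ⊗[𝕂] Osp s :=
  if p ∈ A then comulL hs else tauL hs

section ext
variable (hs : IsGeneric s) {n : ℕ} (A : Finset (Fin n)) (hA : A.Nonempty)

theorem exists_extR (p : Fin n) :
    ∃ f : IR s →ₐ[𝕂] Pow s n,
      (∀ w x, runR hs A hA (Finset.Ico p (A.max' hA)) (w ⊗ₜ x) = w * f x) ∧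
      ∀ z, (∀ q, q = A.max' hA ∨ q ∈ Finset.Ico p (A.max' hA) → ∀ u, Commute (leg s q u) z) →
        ∀ x, Commute (f x) z := by
  obtain ⟨f, h1, h2⟩ := exists_foldl_stepR (coactR hs A) (A.max' hA)
    ((Finset.Ico p (A.max' hA)).sort (· ≤ ·)) (by simp) (Finset.sort_nodup _ _)
  exact ⟨f, h1, by simpa using h2⟩

theorem exists_extL (p : Fin n) :
    ∃ f : IL s →ₐ[𝕂] Pow s n,
      ∀ w x, runL hs A hA (Finset.Ioc (A.min' hA) p) (x ⊗ₜ w) = f x * w := by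
  obtain ⟨f, h, -⟩ := exists_foldl_stepL (coactL hs A) (A.min' hA)
    ((Finset.Ioc (A.min' hA) p).sort (· ≥ ·)) (by simp) (Finset.sort_nodup _ _)
  exact ⟨f, h⟩

/-- The right extension process of `A`, started with an element of `I_R` in position `p`. -/
noncomputable def extR (p : Fin n) : IR s →ₐ[𝕂] Pow s n := (exists_extR hs A hA p).choose

/-- The left extension process of `A`, started with an element of `I_L` in position `p`. -/
noncomputable def extL (p : Fin n) : IL s →ₐ[𝕂] Pow s n := (exists_extL hs A hA p).choose

theorem runR_Ico (p : Fin n) (w : Pow s n) (x : IR s) :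
    runR hs A hA (Finset.Ico p (A.max' hA)) (w ⊗ₜ x) = w * extR hs A hA p x :=
  (exists_extR hs A hA p).choose_spec.1 w x

theorem runL_Ioc (p : Fin n) (x : IL s) (w : Pow s n) :
    runL hs A hA (Finset.Ioc (A.min' hA) p) (x ⊗ₜ w) = extL hs A hA p x * w :=
  (exists_extL hs A hA p).choose_spec w x

variable {hs A hA}

/-- The extension from `p` has `1` outside the positions `p, …, max A`; this is recorded through
what commutes with it. -/
theorem extR_commute {p : Fin n} (hp : p ≤ A.max' hA) {z : Pow s n}
    (hz : ∀ q, p ≤ q → q ≤ A.max' hA → ∀ u, Commute (leg s q u) z) (x : IR s) :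
    Commute (extR hs A hA p x) z := by
  refine (exists_extR hs A hA p).choose_spec.2 z (fun q hq => ?_) x
  rcases hq with rfl | hq
  · exact hz _ hp le_rfl
  · rw [Finset.mem_Ico] at hq; exact hz q hq.1 hq.2.le

theorem extR_max (x : IR s) : extR hs A hA (A.max' hA) x = leg s (A.max' hA) x := by
  have h := runR_Ico hs A hA (A.max' hA) 1 x
  rw [one_mul] at h
  rw [← h]
  simp [runR, insertR]

theorem extL_min (x : IL s) : extL hs A hA (A.min' hA) x = leg s (A.min' hA) x := by
  have h := runL_Ioc hs A hA (A.min' hA) x 1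
  rw [mul_one] at h
  rw [← h]
  simp [runL, insertL]

/-- `u ⊗ x ↦ (u in position p) · (x extended to the right from position p')`. -/
noncomputable def glueR (hs : IsGeneric s) (A : Finset (Fin n)) (hA : A.Nonempty) (p p' : Fin n) :
    Osp s ⊗[𝕂] IR s →ₗ[𝕂] Pow s n :=
  LinearMap.mul' 𝕂 (Pow s n) ∘ₗ
    TensorProduct.map (leg s p).toLinearMap (extR hs A hA p').toLinearMap

/-- `x ⊗ u ↦ (x extended to the left from position p) · (u in position p')`. -/
noncomputable def glueL (hs : IsGeneric s) (A : Finset (Fin n)) (hA : A.Nonempty) (p p' : Fin n) :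
    IL s ⊗[𝕂] Osp s →ₗ[𝕂] Pow s n :=
  LinearMap.mul' 𝕂 (Pow s n) ∘ₗ
    TensorProduct.map (extL hs A hA p).toLinearMap (leg s p').toLinearMap

theorem glueR_tmul (p p' : Fin n) (u : Osp s) (x : IR s) :
    glueR hs A hA p p' (u ⊗ₜ x) = leg s p u * extR hs A hA p' x := by simp [glueR]

theorem glueL_tmul (p p' : Fin n) (x : IL s) (u : Osp s) :
    glueL hs A hA p p' (x ⊗ₜ u) = extL hs A hA p x * leg s p' u := by simp [glueL]

/-- The recursion behind all later inductions: `p` is the least position of the interval, so its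
step is the first one, and the rest is the process from the next position. -/
theorem extR_of_covBy {p p' : Fin n} (hpp : p ⋖ p') (hp : p < A.max' hA) (x : IR s) :
    extR hs A hA p x = glueR hs A hA p p' (coactR hs A p x) := by
  have hI : Finset.Ico p (A.max' hA) = insert p (Finset.Ico p' (A.max' hA)) := by
    ext q
    simp only [Finset.mem_Ico, Finset.mem_insert]
    constructor
    · rintro ⟨h1, h2⟩
      rcases h1.eq_or_lt with h | h
      · exact .inl h.symm
      · exact .inr ⟨hpp.ge_of_gt h, h2⟩
    · rintro (rfl | ⟨h1, h2⟩)
      · exact ⟨le_rfl, hp⟩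
      · exact ⟨hpp.lt.le.trans h1, h2⟩
  have hsort : (Finset.Ico p (A.max' hA)).sort (· ≤ ·) =
      p :: (Finset.Ico p' (A.max' hA)).sort (· ≤ ·) := by
    rw [hI]
    refine Finset.sort_insert _ (fun b hb => hpp.lt.le.trans (Finset.mem_Ico.1 hb).1) ?_
    simp [hpp.lt]
  have hrun : runR hs A hA (Finset.Ico p (A.max' hA)) =
      runR hs A hA (Finset.Ico p' (A.max' hA)) ∘ₗ stepR (coactR hs A p) p := by
    rw [runR, hsort, List.foldl_cons]
    refine congrArg (fun f => insertR (A.max' hA) ∘ₗ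
      LinearMap.lTensor (Pow s n) (IR s).val.toLinearMap ∘ₗ f) (foldl_comp _ _ _)
  have h := runR_Ico hs A hA p 1 x
  rw [one_mul] at h
  rw [← h, hrun, LinearMap.comp_apply, comp_stepR _ (extR hs A hA p').toLinearMap
    (runR_Ico hs A hA _), one_mul]
  rfl

theorem extL_of_covBy {p p' : Fin n} (hpp : p ⋖ p') (hp : A.min' hA < p') (x : IL s) :
    extL hs A hA p' x = glueL hs A hA p p' (coactL hs A p' x) := by
  have hI : Finset.Ioc (A.min' hA) p' = insert p' (Finset.Ioc (A.min' hA) p) := by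
    ext q
    simp only [Finset.mem_Ioc, Finset.mem_insert]
    constructor
    · rintro ⟨h1, h2⟩
      rcases h2.eq_or_lt with h | h
      · exact .inl h
      · exact .inr ⟨h1, hpp.le_of_lt h⟩
    · rintro (rfl | ⟨h1, h2⟩)
      · exact ⟨hp, le_rfl⟩
      · exact ⟨h1, h2.trans hpp.lt.le⟩
  have hsort : (Finset.Ioc (A.min' hA) p').sort (· ≥ ·) =
      p' :: (Finset.Ioc (A.min' hA) p).sort (· ≥ ·) := by
    rw [hI]
    refine Finset.sort_insert _ (fun b hb => (Finset.mem_Ioc.1 hb).2.trans hpp.lt.le) ?_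
    simp [hpp.lt]
  have hrun : runL hs A hA (Finset.Ioc (A.min' hA) p') =
      runL hs A hA (Finset.Ioc (A.min' hA) p) ∘ₗ stepL (coactL hs A p') p' := by
    rw [runL, hsort, List.foldl_cons]
    refine congrArg (fun f => insertL (A.min' hA) ∘ₗ
      LinearMap.rTensor (Pow s n) (IL s).val.toLinearMap ∘ₗ f) (foldl_comp _ _ _)
  have h := runL_Ioc hs A hA p' x 1
  rw [mul_one] at h
  rw [← h, hrun, LinearMap.comp_apply, comp_stepL _ (extL hs A hA p).toLinearMap
    (fun w x => runL_Ioc hs A hA _ x w), mul_one]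
  rfl

end ext
-- The coactions on generators, and their compatibility at `Δ(Γ^q)`
section coactions
variable (hs : IsGeneric s)

/-- As `osp_q(1|2) ⊗ I_R` embeds into `osp_q(1|2) ⊗ osp_q(1|2)`, the formula can be checked there,
where `comulR` becomes `Δ`. The next formulas are obtained in the same way. -/
theorem comulR_AmK :
    comulR hs (IR.AmK s) = (Am s * K s) ⊗ₜ[𝕂] IR.K2P s + (1 : Osp s) ⊗ₜ[𝕂] IR.AmK s := by
  apply inclR_injective s
  have h := sat s
  rw [comulR_spec]
  simp only [map_add, Algebra.TensorProduct.map_tmul, AlgHom.id_apply,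
    IR.AmK, IR.K2P, Subalgebra.coe_val, comul, map_mul, lift_Am, lift_K, add_mul,
    Algebra.TensorProduct.tmul_mul_tmul, h.Kinv_K, mul_assoc, h.P_K, sq]

theorem comulR_ApK :
    comulR hs (IR.ApK s) = (Ap s * K s) ⊗ₜ[𝕂] IR.K2P s + (1 : Osp s) ⊗ₜ[𝕂] IR.ApK s := by
  apply inclR_injective s
  have h := sat s
  rw [comulR_spec]
  simp only [map_add, Algebra.TensorProduct.map_tmul, AlgHom.id_apply,
    IR.ApK, IR.K2P, Subalgebra.coe_val, comul, map_mul, lift_Ap, lift_K, add_mul,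
    Algebra.TensorProduct.tmul_mul_tmul, h.Kinv_K, mul_assoc, h.P_K, sq]

theorem comulR_K2P : comulR hs (IR.K2P s) = (K s ^ 2 * P s) ⊗ₜ[𝕂] IR.K2P s := by
  apply inclR_injective s
  rw [comulR_spec]
  simp only [Algebra.TensorProduct.map_tmul, AlgHom.id_apply,
    IR.K2P, Subalgebra.coe_val, comul, map_mul, lift_P, lift_K, sq,
    Algebra.TensorProduct.tmul_mul_tmul]

theorem comulR_cas : comulR hs (IR.cas s) =
    Algebra.TensorProduct.map (IL s).val (AlgHom.id 𝕂 (IR s)) (casimirLR s) := by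
  apply inclR_injective s
  rw [comulR_spec, ← AlgHom.comp_apply, ← Algebra.TensorProduct.map_comp]
  exact (casimirLR_spec hs).symm

theorem comulL_ApKinvP : comulL hs (IL.ApKinvP s) =
    IL.ApKinvP s ⊗ₜ[𝕂] (1 : Osp s) + IL.Kinv2P s ⊗ₜ[𝕂] (Ap s * Kinv s * P s) := by
  apply inclL_injective s
  have h := sat s
  rw [comulL_spec]
  simp only [map_add, Algebra.TensorProduct.map_tmul, AlgHom.id_apply,
    IL.ApKinvP, IL.Kinv2P, Subalgebra.coe_val, comul, map_mul, lift_Ap, lift_Kinv, lift_P,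
    add_mul, Algebra.TensorProduct.tmul_mul_tmul, h.K_Kinv, mul_assoc, h.P_Kinv, sq,
    lassoc h.P_Kinv, h.p_p, mul_one]

theorem comulL_AmKinvP : comulL hs (IL.AmKinvP s) =
    IL.AmKinvP s ⊗ₜ[𝕂] (1 : Osp s) + IL.Kinv2P s ⊗ₜ[𝕂] (Am s * Kinv s * P s) := by
  apply inclL_injective s
  have h := sat s
  rw [comulL_spec]
  simp only [map_add, Algebra.TensorProduct.map_tmul, AlgHom.id_apply,
    IL.AmKinvP, IL.Kinv2P, Subalgebra.coe_val, comul, map_mul, lift_Am, lift_Kinv, lift_P,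
    add_mul, Algebra.TensorProduct.tmul_mul_tmul, h.K_Kinv, mul_assoc, h.P_Kinv, sq,
    lassoc h.P_Kinv, h.p_p, mul_one]

theorem comulL_Kinv2P : comulL hs (IL.Kinv2P s) = IL.Kinv2P s ⊗ₜ[𝕂] (Kinv s ^ 2 * P s) := by
  apply inclL_injective s
  rw [comulL_spec]
  simp only [Algebra.TensorProduct.map_tmul, AlgHom.id_apply,
    IL.Kinv2P, Subalgebra.coe_val, comul, map_mul, lift_P, lift_Kinv, sq,
    Algebra.TensorProduct.tmul_mul_tmul]

theorem comulL_cas : comulL hs (IL.cas s) =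
    Algebra.TensorProduct.map (AlgHom.id 𝕂 (IL s)) (IR s).val (casimirLR s) := by
  apply inclL_injective s
  rw [comulL_spec, ← AlgHom.comp_apply, ← Algebra.TensorProduct.map_comp]
  exact (casimirLR_spec hs).symm

/-- Coassociativity at `Γ^q`. -/
theorem comulR_comulL : LinearMap.lTensor (IL s) (comulR hs).toLinearMap (casimirLR s) =
    (TensorProduct.assoc 𝕂 (IL s) (Osp s) (IR s)).toLinearMap
      (LinearMap.rTensor (IR s) (comulL hs).toLinearMap (casimirLR s)) := by
  have hα : ∀ x y z, (TensorProduct.assoc 𝕂 (IL s) (Osp s) (IR s)).toLinearMap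
    (x ⊗ₜ y ⊗ₜ z) = x ⊗ₜ (y ⊗ₜ z) := fun _ _ _ => rfl
  -- Only linearity of the associator and its values on pure tensors are needed, so it is replaced
  -- by an abstract linear map.
  generalize (TensorProduct.assoc 𝕂 (IL s) (Osp s) (IR s)).toLinearMap = α at hα ⊢
  simp only [casimirLR, map_add, map_sub, map_smul, LinearMap.lTensor_tmul, LinearMap.rTensor_tmul,
    AlgHom.toLinearMap_apply, comulR_AmK, comulR_ApK, comulR_K2P, comulR_cas, comulL_ApKinvP,
    comulL_AmKinvP, comulL_Kinv2P, comulL_cas, Algebra.TensorProduct.map_tmul, AlgHom.id_apply,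
    hα, TensorProduct.add_tmul, TensorProduct.tmul_add,
    TensorProduct.sub_tmul, TensorProduct.tmul_sub, ← TensorProduct.smul_tmul',
    TensorProduct.tmul_smul, smul_add, smul_sub, smul_smul, Subalgebra.coe_val]
  -- The middle factors come from `I_L` on one side and from `I_R` on the other; unfolding
  -- identifies them as the same elements of `osp_q(1|2)`.
  simp only [IL.cas, IR.cas, IL.Kinv2P, IL.ApKinvP, IL.AmKinvP, IR.AmK, IR.ApK, IR.K2P]
  module

/-- The two coactions agree at `Δ(Γ^q)`. -/
theorem tauR_tauL : LinearMap.lTensor (IL s) (tauR hs).toLinearMap (casimirLR s) =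
    (TensorProduct.assoc 𝕂 (IL s) (Osp s) (IR s)).toLinearMap
      (LinearMap.rTensor (IR s) (tauL hs).toLinearMap (casimirLR s)) := by
  have hR := isTauR_tauR hs
  have hL := isTauL_tauL hs
  have h2 := hs.sub_ne
  have h2' := hs.add_ne
  have hs := hs.ne_zero
  have h4 : s ^ 2 - (s ^ 2)⁻¹ = (s ^ 2 - 1) * (s ^ 2 + 1) / s ^ 2 := by field_simp; ring
  have h5 : s - s⁻¹ = (s ^ 2 - 1) / s := by field_simp
  have hα : ∀ x y z, (TensorProduct.assoc 𝕂 (IL s) (Osp s) (IR s)).toLinearMap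
    (x ⊗ₜ y ⊗ₜ z) = x ⊗ₜ (y ⊗ₜ z) := fun _ _ _ => rfl
  generalize (TensorProduct.assoc 𝕂 (IL s) (Osp s) (IR s)).toLinearMap = α at hα ⊢
  simp only [casimirLR, map_add, map_sub, map_smul, LinearMap.lTensor_tmul, LinearMap.rTensor_tmul,
    AlgHom.toLinearMap_apply, hR.AmK, hR.ApK, hR.K2P, hR.cas, hL.ApKinvP, hL.AmKinvP, hL.Kinv2P,
    hL.cas, hα, TensorProduct.add_tmul, TensorProduct.tmul_add,
    TensorProduct.sub_tmul, TensorProduct.tmul_sub, ← TensorProduct.smul_tmul',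
    TensorProduct.tmul_smul, smul_add, smul_sub, smul_smul]
  match_scalars
  all_goals try simp only [h4, h5]
  all_goals try field_simp

theorem coactR_coactL {n : ℕ} (A : Finset (Fin n)) (p : Fin n) :
    LinearMap.lTensor (IL s) (coactR hs A p).toLinearMap (casimirLR s) =
      (TensorProduct.assoc 𝕂 (IL s) (Osp s) (IR s)).toLinearMap
        (LinearMap.rTensor (IR s) (coactL hs A p).toLinearMap (casimirLR s)) := by
  by_cases hp : p ∈ A
  · simpa only [coactR, coactL, if_pos hp] using comulR_comulL hs
  · simpa only [coactR, coactL, if_neg hp] using tauR_tauL hs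

end coactions

/-! ### Independence of the extension process -/

section processes
variable {hs : IsGeneric s} {n : ℕ} {A : Finset (Fin n)} {hA : A.Nonempty}

/-- `x ⊗ y ↦ (x extended to the left from position p) · (y extended to the right from position p')`. -/
noncomputable def glueLR (hs : IsGeneric s) (A : Finset (Fin n)) (hA : A.Nonempty) (p p' : Fin n) :
    IL s ⊗[𝕂] IR s →ₗ[𝕂] Pow s n :=
  LinearMap.mul' 𝕂 (Pow s n) ∘ₗ
    TensorProduct.map (extL hs A hA p).toLinearMap (extR hs A hA p').toLinearMap

theorem glueLR_tmul (p p' : Fin n) (x : IL s) (y : IR s) :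
    glueLR hs A hA p p' (x ⊗ₜ y) = extL hs A hA p x * extR hs A hA p' y := by simp [glueLR]

/-- Moving the splitting point past `p'`: opening position `p'` from the right factor or from the
left factor gives the two sides of `coactR_coactL`, the middle tensor factor landing in position
`p'`. -/
theorem glueLR_casimirLR_succ {p p' p'' : Fin n} (h : p ⋖ p') (h' : p' ⋖ p'')
    (hp : A.min' hA ≤ p) (hp' : p' < A.max' hA) :
    glueLR hs A hA p p' (casimirLR s) = glueLR hs A hA p' p'' (casimirLR s) := by
  -- `Φ` sends `x ⊗ u ⊗ y` to the left extension of `x` from `p`, times `u` in position `p'`, times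
  -- the right extension of `y` from `p''`.
  obtain ⟨Φ, hΦ⟩ : ∃ Φ : IL s ⊗[𝕂] (Osp s ⊗[𝕂] IR s) →ₗ[𝕂] Pow s n,
      Φ = LinearMap.mul' 𝕂 (Pow s n) ∘ₗ TensorProduct.map (extL hs A hA p).toLinearMap (glueR hs A hA p' p'') := ⟨_, rfl⟩
  have hR : glueLR hs A hA p p' = Φ ∘ₗ LinearMap.lTensor (IL s) (coactR hs A p').toLinearMap := by
    refine TensorProduct.ext' fun x y => ?_
    rw [glueLR_tmul, extR_of_covBy h' hp']
    simp [hΦ]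
  have hL : glueLR hs A hA p' p'' = Φ ∘ₗ (TensorProduct.assoc 𝕂 (IL s) (Osp s) (IR s)).toLinearMap
      ∘ₗ LinearMap.rTensor (IR s) (coactL hs A p').toLinearMap := by
    refine TensorProduct.ext' fun x y => ?_
    rw [glueLR_tmul, extL_of_covBy h (hp.trans_lt h.lt), LinearMap.comp_apply,
      LinearMap.comp_apply, LinearMap.rTensor_tmul, AlgHom.toLinearMap_apply]
    induction coactL hs A p' x using TensorProduct.induction_on with
    | zero => simp only [TensorProduct.zero_tmul, LinearMap.map_zero, zero_mul]
    | tmul x u =>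
      rw [LinearEquiv.coe_coe, TensorProduct.assoc_tmul, glueL_tmul]
      simp [hΦ, glueR_tmul, mul_assoc]
    | add a b ha hb => simp only [TensorProduct.add_tmul, LinearMap.map_add, add_mul, ha, hb]
  rw [hR, hL, LinearMap.comp_apply, coactR_coactL]
  rfl

/-- The splitting point is moved down to `min A`. There the left extension is a bare insertion, and
since `min A ∈ A` the right process starts with `Δ(Γ^q)`. -/
theorem glueLR_casimirLR {p p' : Fin n} (h : p ⋖ p') (hp : A.min' hA ≤ p)
    (hp' : p < A.max' hA) :
    glueLR hs A hA p p' (casimirLR s) = extR hs A hA (A.min' hA) (IR.cas s) := by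
  induction p using WellFoundedLT.induction generalizing p' with
  | ind p ih =>
  rcases hp.eq_or_lt with rfl | hlt
  · rw [extR_of_covBy h hp', coactR, if_pos (A.min'_mem hA), comulR_cas]
    induction casimirLR s using TensorProduct.induction_on with
    | zero => simp only [map_zero]
    | tmul x y =>
      rw [Algebra.TensorProduct.map_tmul, glueLR_tmul, glueR_tmul, extL_min]
      rfl
    | add a b ha hb => simp only [map_add, ha, hb]
  · obtain ⟨i, hi, hip⟩ := exists_le_covBy_of_lt hlt
    rw [← glueLR_casimirLR_succ hip h hi hp']
    exact ih i hip.lt hip hi (hip.lt.trans hp')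

theorem gammaRight_eq : gammaRight hs A hA = extR hs A hA (A.min' hA) (IR.cas s) := by
  rw [gammaRight, runR_Ico, one_mul]

theorem gammaLeft_eq : gammaLeft hs A hA = extR hs A hA (A.min' hA) (IR.cas s) := by
  rw [gammaLeft, runL_Ioc, mul_one]
  -- For a singleton no step is performed. Otherwise the left process begins with `Δ` at `max A ∈
  -- A`, which is the splitting just below `max A`.
  rcases (A.min'_le_max' hA).eq_or_lt with h | h
  · rw [← h, extL_min]
    conv_rhs => rw [h, extR_max, ← h]
    rfl
  · obtain ⟨i, hi, him⟩ := exists_le_covBy_of_lt h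
    rw [← glueLR_casimirLR him hi him.lt, extL_of_covBy him h, coactL, if_pos (A.max'_mem hA),
      comulL_cas]
    induction casimirLR s using TensorProduct.induction_on with
    | zero => simp only [map_zero]
    | tmul x y =>
      rw [Algebra.TensorProduct.map_tmul, glueLR_tmul, glueL_tmul, extR_max]
      rfl
    | add a b ha hb => simp only [map_add, ha, hb]

theorem gammaMixed_eq (hA : A.Nonempty) {j : Fin n} (hj : j ∈ A) (hj' : j ≠ A.max' hA) :
    gammaMixed hs A hA j = extR hs A hA (A.min' hA) (IR.cas s) := by
  have hlt : j < A.max' hA := (A.le_max' j hj).lt_of_ne hj'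
  obtain ⟨i, hi, -⟩ := exists_covBy_le_of_lt hlt
  -- After the initial `Δ` the last factor is in position `i`, the successor of `j`, so the
  -- remaining right steps form the right process from `i`.
  have hI : Finset.Ioo j (A.max' hA) = Finset.Ico i (A.max' hA) := by
    ext q
    simp only [Finset.mem_Ioo, Finset.mem_Ico]
    exact and_congr_left fun _ => ⟨hi.ge_of_gt, hi.lt.trans_le⟩
  rw [← glueLR_casimirLR (hA := hA) hi (A.min'_le j hj) hlt, gammaMixed, hI]
  induction casimirLR s using TensorProduct.induction_on with
  | zero => simp only [map_zero]
  | tmul x y =>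
    rw [LinearMap.lTensor_tmul, LinearMap.comp_apply, TensorProduct.mk_apply, runR_Ico, runL_Ioc,
      glueLR_tmul, one_mul]
  | add a b ha hb => simp only [map_add, ha, hb]

theorem IsGamma.eq_extR {x : Pow s n} (hx : IsGamma hs A x) (hA : A.Nonempty) :
    x = extR hs A hA (A.min' hA) (IR.cas s) := by
  cases hx with
  | empty => exact absurd hA Finset.not_nonempty_empty
  | right => exact gammaRight_eq
  | left => exact gammaLeft_eq
  | mixed _ _ _ hj hj' => exact gammaMixed_eq hA hj hj'

end processes
-- The counit, and exchange relations between algebra morphisms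
theorem counit_sat (s : 𝕂) : Sat s (0 : 𝕂) 0 1 1 1 := by
  constructor <;> simp

/-- The counit of `osp_q(1|2)`. -/
noncomputable def counit (s : 𝕂) : Osp s →ₐ[𝕂] 𝕂 := lift (counit_sat s)

theorem counit_casimir (s : 𝕂) : counit s (casimir s) = (s⁻¹ - s) / (s ^ 2 - (s ^ 2)⁻¹) := by
  simp only [counit, casimir, map_mul, map_add, map_neg, map_smul, map_sub, map_pow, lift_Ap,
    lift_Am, lift_K, lift_Kinv, lift_P, smul_eq_mul]
  ring

/-- The counit on `I_R`, with values in the scalars of an algebra. -/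
noncomputable def counitR (s : 𝕂) (R : Type*) [Ring R] [Algebra 𝕂 R] : IR s →ₐ[𝕂] R :=
  (Algebra.ofId 𝕂 R).comp ((counit s).comp (IR s).val)

section
variable {R : Type*} [Ring R] [Algebra 𝕂 R]

theorem counitR_AmK : counitR s R (IR.AmK s) = 0 := by
  simp [counitR, IR.AmK, counit, lift_Am]

theorem counitR_ApK : counitR s R (IR.ApK s) = 0 := by
  simp [counitR, IR.ApK, counit, lift_Ap]

theorem counitR_K2P : counitR s R (IR.K2P s) = 1 := by
  simp [counitR, IR.K2P, counit, lift_K, lift_P]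

theorem counitR_cas : counitR s R (IR.cas s) =
    algebraMap 𝕂 R ((s⁻¹ - s) / (s ^ 2 - (s ^ 2)⁻¹)) := by
  simp only [counitR, IR.cas, AlgHom.comp_apply, Subalgebra.coe_val, counit_casimir,
    Algebra.ofId_apply]

theorem counitR_commute (x : IR s) (z : R) : Commute z (counitR s R x) :=
  Algebra.commutes' _ z |>.symm

/-- The exchange relations between two algebra morphisms on `I_R`. -/
def ExchangeHom (f g : IR s →ₐ[𝕂] R) : Prop :=
  Exchange s (f (IR.AmK s)) (f (IR.ApK s)) (f (IR.K2P s)) (f (IR.cas s))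
    (g (IR.AmK s)) (g (IR.ApK s)) (g (IR.K2P s)) (g (IR.cas s))

theorem Exchange.map {S : Type*} [Ring S] [Algebra 𝕂 S] {Xa Xb Xc Xg ya yb yc yg : R}
    (r : Exchange s Xa Xb Xc Xg ya yb yc yg) (F : R →ₐ[𝕂] S) :
    Exchange s (F Xa) (F Xb) (F Xc) (F Xg) (F ya) (F yb) (F yc) (F yg) := by
  constructor
  all_goals simp only [← map_mul, ← map_smul, ← map_add, ← map_sub, ← map_neg]
  exacts [congrArg F r.a_a, congrArg F r.a_b, congrArg F r.a_c, congrArg F r.a_g,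
    congrArg F r.b_a, congrArg F r.b_b, congrArg F r.b_c, congrArg F r.b_g,
    congrArg F r.c_a, congrArg F r.c_b, congrArg F r.c_c, congrArg F r.c_g,
    congrArg F r.g_a, congrArg F r.g_b, congrArg F r.g_c, congrArg F r.g_g]

theorem exchangeHom_counitR (hs : IsGeneric s) (f : IR s →ₐ[𝕂] R) :
    ExchangeHom f (counitR s R) := by
  rw [ExchangeHom, counitR_AmK, counitR_ApK, counitR_K2P, counitR_cas]
  exact Exchange.counit hs _ _ _ _

/-- The four membership cases for `p` reduce to three: `p ∉ A` with `p ∈ B` contradicts `B ⊆ A`.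
Each of the others is one of the stability results for `Exchange`. -/
theorem ExchangeHom.map_id {f g : IR s →ₐ[𝕂] R} (r : ExchangeHom f g) (hs : IsGeneric s)
    {n : ℕ} {A B : Finset (Fin n)} (hBA : B ⊆ A) (p : Fin n) :
    ExchangeHom ((Algebra.TensorProduct.map (AlgHom.id 𝕂 (Osp s)) f).comp (coactR hs A p))
      ((Algebra.TensorProduct.map (AlgHom.id 𝕂 (Osp s)) g).comp (coactR hs B p)) := by
  have hτ := isTauR_tauR hs
  have hΔ : ∀ h : IR s →ₐ[𝕂] R,
      Algebra.TensorProduct.map (AlgHom.id 𝕂 (Osp s)) h (comulR hs (IR.cas s)) =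
        casimir s ⊗ₜ[𝕂] h (IR.K2P s) + (Kinv s ^ 2 * P s) ⊗ₜ[𝕂] h (IR.cas s)
        + ((s - s⁻¹) / (s ^ 2 - (s ^ 2)⁻¹)) • ((Kinv s ^ 2 * P s) ⊗ₜ[𝕂] h (IR.K2P s))
        + s⁻¹ • ((Ap s * Kinv s * P s) ⊗ₜ[𝕂] h (IR.AmK s))
        - s • ((Am s * Kinv s * P s) ⊗ₜ[𝕂] h (IR.ApK s)) := by
    intro h
    simp only [comulR_cas, casimirLR, map_add, map_sub, map_smul, Algebra.TensorProduct.map_tmul,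
      AlgHom.id_apply, Subalgebra.coe_val, IL.cas, IL.Kinv2P, IL.ApKinvP, IL.AmKinvP]
  by_cases hA : p ∈ A
  · by_cases hB : p ∈ B
    · simpa only [ExchangeHom, coactR, if_pos hA, if_pos hB, AlgHom.comp_apply, hΔ, comulR_AmK,
        comulR_ApK, comulR_K2P, map_add, Algebra.TensorProduct.map_tmul, AlgHom.id_apply] using
        Exchange.comul_comul r hs
    · simpa only [ExchangeHom, coactR, if_pos hA, if_neg hB, AlgHom.comp_apply, hΔ, comulR_AmK,
        comulR_ApK, comulR_K2P, map_add, map_sub, map_smul, Algebra.TensorProduct.map_tmul,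
        AlgHom.id_apply, hτ.AmK, hτ.ApK, hτ.K2P, hτ.cas] using Exchange.comul_tau r hs
  · simpa only [ExchangeHom, coactR, if_neg hA, if_neg (fun h => hA (hBA h)), AlgHom.comp_apply,
      map_add, map_sub, map_smul, Algebra.TensorProduct.map_tmul,
      AlgHom.id_apply, hτ.AmK, hτ.ApK, hτ.K2P, hτ.cas] using Exchange.tau_tau r hs

/-- The exchange relations are preserved by a common step of two right extension processes. -/
theorem ExchangeHom.lift {f g : IR s →ₐ[𝕂] R} (r : ExchangeHom f g) (hs : IsGeneric s)
    {n : ℕ} {A B : Finset (Fin n)} (hBA : B ⊆ A) (p : Fin n) (l : Osp s →ₐ[𝕂] R)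
    (hf : ∀ u x, Commute (l u) (f x)) (hg : ∀ u x, Commute (l u) (g x)) :
    ExchangeHom ((Algebra.TensorProduct.lift l f hf).comp (coactR hs A p))
      ((Algebra.TensorProduct.lift l g hg).comp (coactR hs B p)) := by
  -- Multiplication `Osp s ⊗ R → R` along `l` need not be an algebra morphism, but it is one on `Osp
  -- s ⊗ Z`, where `Z` is the centralizer of the image of `l`. Both `f` and `g` take values in `Z`,
  -- so the step can be done over `Z` and then pushed into `R`.
  set Z := Subalgebra.centralizer 𝕂 (Set.range l)
  have hfZ : ∀ x, f x ∈ Z := by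
    rintro x _ ⟨u, rfl⟩
    exact hf u x
  have hgZ : ∀ x, g x ∈ Z := by
    rintro x _ ⟨u, rfl⟩
    exact hg u x
  have rZ : ExchangeHom (f.codRestrict Z hfZ) (g.codRestrict Z hgZ) := by
    constructor
    all_goals apply Subtype.ext
    exacts [r.a_a, r.a_b, r.a_c, r.a_g, r.b_a, r.b_b, r.b_c, r.b_g, r.c_a, r.c_b, r.c_c, r.c_g,
      r.g_a, r.g_b, r.g_c, r.g_g]
  have hl : ∀ u (z : Z), Commute (l u) (Z.val z) := fun u z => z.2 _ ⟨u, rfl⟩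
  have key : ∀ (h : IR s →ₐ[𝕂] R) (hh : ∀ u x, Commute (l u) (h x)) (hhZ : ∀ x, h x ∈ Z),
      Algebra.TensorProduct.lift l h hh = (Algebra.TensorProduct.lift l Z.val hl).comp
        (Algebra.TensorProduct.map (AlgHom.id 𝕂 (Osp s)) (h.codRestrict Z hhZ)) := by
    intro h hh hhZ
    apply Algebra.TensorProduct.ext'
    intro u x
    simp
  rw [key f hf hfZ, key g hg hgZ]
  exact Exchange.map (rZ.map_id hs hBA p) (Algebra.TensorProduct.lift l Z.val hl)

/-- The counit axiom `(id ⊗ ε)Δ = id` on `I_R`, composed with `l`. It suffices to check the four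
generators. -/
theorem lift_counitR_comp_comulR (hs : IsGeneric s) (l : Osp s →ₐ[𝕂] R) :
    (Algebra.TensorProduct.lift l (counitR s R) fun u x => counitR_commute x (l u)).comp
      (comulR hs) = l.comp (IR s).val := by
  refine algHom_ext_IR ?_ ?_ ?_ ?_
  · simp only [AlgHom.comp_apply, comulR_AmK, map_add, Algebra.TensorProduct.lift_tmul,
      counitR_AmK, counitR_K2P, mul_zero, mul_one, add_zero]
    rfl
  · simp only [AlgHom.comp_apply, comulR_ApK, map_add, Algebra.TensorProduct.lift_tmul,
      counitR_ApK, counitR_K2P, mul_zero, mul_one, add_zero]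
    rfl
  · simp only [AlgHom.comp_apply, comulR_K2P, Algebra.TensorProduct.lift_tmul, counitR_K2P,
      mul_one]
    rfl
  · simp only [AlgHom.comp_apply, comulR_cas, casimirLR, map_add, map_sub, map_smul,
      Algebra.TensorProduct.map_tmul, AlgHom.id_apply, Algebra.TensorProduct.lift_tmul,
      counitR_AmK, counitR_ApK, counitR_K2P, counitR_cas, mul_zero, mul_one, smul_zero, add_zero,
      sub_zero, Algebra.algebraMap_eq_smul_one, mul_smul_comm, add_assoc, ← add_smul]
    -- The coefficient of `K⁻²P` is `ε(Γ^q)` plus the coefficient of `K⁻²P ⊗ K²P` in `Δ(Γ^q)`; these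
    -- are opposite.
    rw [← add_div, sub_add_sub_cancel, sub_self, zero_div, zero_smul, add_zero]
    rfl

end

/-! ### Commutation of the right extensions -/

section extensions
variable {hs : IsGeneric s} {n : ℕ} {A B : Finset (Fin n)} {hA : A.Nonempty} {hB : B.Nonempty}

theorem leg_commute_extR {p p' : Fin n} (hp : p < p') (hp' : p' ≤ A.max' hA) (u : Osp s)
    (x : IR s) : Commute (leg s p u) (extR hs A hA p' x) :=
  (extR_commute hp' (fun _ hq _ _ => leg_commute (hp.trans_le hq).ne' _ _) x).symm

theorem extR_eq_lift {p p' : Fin n} (hpp : p ⋖ p') (hp : p < A.max' hA) :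
    extR hs A hA p = (Algebra.TensorProduct.lift (leg s p) (extR hs A hA p')
      (leg_commute_extR hpp.lt (hpp.ge_of_gt hp))).comp (coactR hs A p) := by
  ext x : 1
  rw [extR_of_covBy hpp hp, AlgHom.comp_apply, ← mul'_map_eq_lift]
  rfl

/-- The last position is treated as one more step, with coaction `Δ` since `max A ∈ A`, after which
the process is continued by the counit. This gives the base case of the induction the same shape as
its step. -/
theorem extR_max_eq_lift : extR hs A hA (A.max' hA) =
    (Algebra.TensorProduct.lift (leg s (A.max' hA)) (counitR s (Pow s n))
      fun u x => counitR_commute x (leg s _ u)).comp (coactR hs A (A.max' hA)) := by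
  rw [coactR, if_pos (A.max'_mem hA), lift_counitR_comp_comulR]
  ext x : 1
  exact extR_max x

/-- The right extension processes of `B ⊆ A` satisfy the exchange relations. -/
theorem exchangeHom_extR (hBA : B ⊆ A) {p : Fin n} (hp : p ≤ B.max' hB) :
    ExchangeHom (extR hs A hA p) (extR hs B hB p) := by
  have hmax : B.max' hB ≤ A.max' hA := A.le_max' _ (hBA (B.max'_mem hB))
  induction p using WellFoundedGT.induction with
  | ind p ih =>
  rcases hp.eq_or_lt with rfl | hlt
  · rw [extR_max_eq_lift]
    -- The extension of `B` is continued by the counit in both cases. That of `A` is continued by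
    -- the counit if the maxima agree and by a genuine extension otherwise; the counit satisfies the
    -- exchange relations against either.
    rcases hmax.eq_or_lt with h | h
    · rw [h, extR_max_eq_lift]
      exact (exchangeHom_counitR hs _).lift hs hBA _ _ _ _
    · obtain ⟨p', hp', -⟩ := exists_covBy_le_of_lt h
      rw [extR_eq_lift hp' h]
      exact (exchangeHom_counitR hs _).lift hs hBA _ _ _ _
  · obtain ⟨p', hp', hle⟩ := exists_covBy_le_of_lt hlt
    rw [extR_eq_lift hp' (hlt.trans_le hmax), extR_eq_lift hp' hlt]
    exact (ih p' hp'.lt hle).lift hs hBA _ _ _ _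

/-- The relations `a_g`, `b_g`, `c_g`, `g_g` are plain commutations and settle the generators of
`I_R`. The other twelve serve only to keep the induction going. -/
theorem extR_min_commute (hBA : B ⊆ A) (x : IR s) :
    Commute (extR hs A hA (B.min' hB) x) (extR hs B hB (B.min' hB) (IR.cas s)) := by
  have r : ExchangeHom (extR hs A hA (B.min' hB)) (extR hs B hB (B.min' hB)) :=
    exchangeHom_extR hBA (B.min'_le_max' hB)
  obtain ⟨x, hx⟩ := x
  induction hx using Algebra.adjoin_induction with
  | mem x h =>
    rcases h with rfl | rfl | rfl | rfl
    exacts [r.a_g, r.b_g, r.c_g, r.g_g]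
  | algebraMap k =>
    have : (⟨algebraMap 𝕂 (Osp s) k, (IR s).algebraMap_mem k⟩ : IR s) = algebraMap 𝕂 (IR s) k := rfl
    exact this ▸ (AlgHom.commutes (extR hs A hA (B.min' hB)) k) ▸ Algebra.commutes k _
  | add x y hx hy h h' =>
    have : (⟨x + y, (IR s).add_mem hx hy⟩ : IR s) = ⟨x, hx⟩ + ⟨y, hy⟩ := rfl
    rw [this, map_add]
    exact h.add_left h'
  | mul x y hx hy h h' =>
    have : (⟨x * y, (IR s).mul_mem hx hy⟩ : IR s) = ⟨x, hx⟩ * ⟨y, hy⟩ := rfl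
    rw [this, map_mul]
    exact h.mul_left h'

/-- Each position below `min B` contributes a single tensor leg, which is disjoint from the
extension of `B`. So commutation propagates downwards from `min B`. -/
theorem extR_commute_extR_min (hBA : B ⊆ A) {p : Fin n} (hp : p ≤ B.min' hB) (x : IR s) :
    Commute (extR hs A hA p x) (extR hs B hB (B.min' hB) (IR.cas s)) := by
  have hmax : B.max' hB ≤ A.max' hA := A.le_max' _ (hBA (B.max'_mem hB))
  have hmin := B.min'_le_max' hB
  induction p using WellFoundedGT.induction generalizing x with
  | ind p ih =>
  rcases hp.eq_or_lt with rfl | hlt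
  · exact extR_min_commute hBA x
  · obtain ⟨p', hp', hle⟩ := exists_covBy_le_of_lt hlt
    rw [extR_of_covBy hp' (hlt.trans_le (hmin.trans hmax))]
    induction coactR hs A p x using TensorProduct.induction_on with
    | zero => rw [map_zero]; exact Commute.zero_left _
    | tmul u y =>
      rw [glueR_tmul]
      exact (leg_commute_extR hlt hmin u _).mul_left (ih p' hp'.lt hle y)
    | add a b ha hb => rw [map_add]; exact ha.add_left hb

end extensions

end Osp
end QBannaiIto

theorem theorem8p2 {𝕂 : Type*} [Field 𝕂] (s : 𝕂) (hs : QBannaiIto.Osp.IsGeneric s) (n : ℕ)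
    (A B : Finset (Fin n)) (hBA : B ⊆ A) (x y : QBannaiIto.Osp.Pow s n)
    (hx : QBannaiIto.Osp.IsGamma hs A x) (hy : QBannaiIto.Osp.IsGamma hs B y) :
    Commute x y := by
  rcases B.eq_empty_or_nonempty with rfl | hB
  · cases hy with
    | empty => exact (Algebra.commutes _ x).symm
    | right _ h => exact absurd h Finset.not_nonempty_empty
    | left _ h => exact absurd h Finset.not_nonempty_empty
    | mixed _ h => exact absurd h Finset.not_nonempty_empty
  -- Whatever processes produced `x` and `y`, they are the right extensions from `min A` and `min
  -- B`, and `min A ≤ min B`.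
  · rw [hx.eq_extR (hB.mono hBA), hy.eq_extR hB]
    exact QBannaiIto.Osp.extR_commute_extR_min hBA
      (A.min'_le _ (hBA (B.min'_mem hB))) _
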